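/- Let $(\epsilon_n)$ be real numbers with $n\epsilon_n^2\to 0$ and $n\epsilon_n/\log n\to\infty$ as $n\to\infty$. For each $n$ let $V_n$ be a sample of $n$ i.i.d. uniform points of the unit circle $\mathbb S^1=\{z\in\mathbb C:|z|=1\}$, labelled counterclockwise $x_0,\dots,x_{n-1}$, and let $G_n$ be the graph on $\{0,\dots,n-1\}$ in which $i\sim j$ if and only if $i\ne j$ and the geodesic distance of $x_i$ and $x_j$ is less than $\epsilon_n$. Consider the Kuramoto system $$\dot u_i=\frac{\pi}{n^2\epsilon_n^3}\sum_{j\sim i}\sin(u_j-u_i),\qquad 0\le i\le n-1,$$ which is the gradient system $\dot u=-\nabla E_n(u)$ of the energy $$E_n(u)=\frac{\pi}{2n^2\epsilon_n^3}\sum_{i}\sum_{j\sim i}\bigl(1-\cos(u_j-u_i)\bigr).$$ The energy is also regarded as a function on the torus $\mathbb T^n=(\mathbb S^1)^n$ through $z_j=e^{\mathrm i u_j}$. Since the system is invariant under $u\mapsto u+c(1,\dots,1)$ and conserves $\sum_i u_i$, asymptotic stability of an equilibrium $u$ always refers to the system restricted to the invariant hyperplane of phases with the same sum as $u$. For $\mathbf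 z\in\mathbb T^n$ such that $z_{j}\neq -z_{j-1}$ for $1\le j\le n$ (where $z_n:=z_0$), the index is $$I(\mathbf z)=\frac1{2\pi \mathrm i}\int_{\gamma_{\mathbf z}}\frac{dz}{z}\in\mathbb Z,$$ where $\gamma_{\mathbf z}$ is the closed curve obtained by concatenating the geodesics of $\mathbb S^1$ from $z_{j-1}$ to $z_j$, $1\le j\le n$; otherwise the index is undefined. Let $K_q=\{\mathbf z\in\mathbb T^n: I(\mathbf z)=q\}$; the index of $u\in\mathbb R^n$ is that of $(e^{\mathrm i u_0},\dots,e^{\mathrm i u_{n-1}})$. Then for every $q\in\mathbb Z$: 1. the probability that the Kuramoto system has an asymptotically stable equilibrium $u$ with $\sum_i u_i=0$ and index $q$ tends to $1$ as $n\to\infty$; 2. the probability of the following event tends to $1$ as $n\to\infty$: $E_n$ attains its minimum over the closure $\overline{K_q}$ in $\mathbb T^n$, every minimiser $\mathbf z$ of $E_n$ over $\overline{K_q}$ lies in the interior of $K_q$, and every $u\in\mathbb R^n$ with $\mathbf z=(e^{\mathrm i u_0},\dots,e^{\mathrm i u_{n-1}})$ is an asymptotically stable equilibrium. -/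

import Mathlib

open MeasureTheory ProbabilityTheory Filter Topology

noncomputable section

namespace Kuramoto

/-! ### The nodes and the random geometric graph -/

instance instMeasurableSpaceCircle : MeasurableSpace Circle := borel Circle

instance instBorelSpaceCircle : BorelSpace Circle := ⟨rfl⟩

/-- The uniform probability law on the unit circle `{z ∈ ℂ : |z| = 1}`. -/
def uniformCircle : Measure Circle :=
  Measure.map Circle.exp (cond volume (Set.Ico (0 : ℝ) (2 * Real.pi)))

/-- The angle of a point of the circle, taken in `[0, 2π)`. -/
def angle (x : Circle) : ℝ := toIcoMod Real.two_pi_pos 0 (Complex.arg (x : ℂ))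

/-- The sample `x`, relabelled counterclockwise (by increasing angle in `[0, 2π)`). -/
def nodes {n : ℕ} (x : Fin n → Circle) : Fin n → Circle :=
  x ∘ Tuple.sort (fun i => angle (x i))

/-- The geodesic distance on the circle, the arc cosine of the scalar product. -/
def geodesicDist (x y : Circle) : ℝ := Real.arccos (inner ℝ (x : ℂ) (y : ℂ))

/-- The random geometric graph: the nodes, labelled counterclockwise, are joined when their geodesic
distance is less than `ε`. -/
def rgg {n : ℕ} (x : Fin n → Circle) (ε : ℝ) : SimpleGraph (Fin n) where
  Adj i j := i ≠ j ∧ geodesicDist (nodes x i) (nodes x j) < ε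
  symm := ⟨by
    rintro i j ⟨h, hd⟩
    refine ⟨h.symm, ?_⟩
    unfold geodesicDist at hd ⊢
    rwa [real_inner_comm]⟩
  loopless := ⟨fun _ h => h.1 rfl⟩

/-! ### The Kuramoto system and its energy -/

open Classical in
/-- The right-hand side of the Kuramoto system
`du_i/dt = π / (n² ε³) ∑_{j ∼ i} sin (u_j - u_i)` on a graph with `n` nodes. -/
def field {n : ℕ} (G : SimpleGraph (Fin n)) (ε : ℝ) (u : Fin n → ℝ) : Fin n → ℝ :=
  fun i => Real.pi / ((n : ℝ) ^ 2 * ε ^ 3) *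
    ∑ j ∈ Finset.univ.filter (fun j => G.Adj i j), Real.sin (u j - u i)

open Classical in
/-- The energy on the torus, `π / (2 n² ε³) ∑_i ∑_{j ∼ i} (1 - cos (u_j - u_i))` where
`z_k = exp (i u_k)`, so that `cos (u_j - u_i)` is the real part of `z_j / z_i`. -/
def energy {n : ℕ} (G : SimpleGraph (Fin n)) (ε : ℝ) (z : Fin n → Circle) : ℝ :=
  Real.pi / (2 * (n : ℝ) ^ 2 * ε ^ 3) *
    ∑ i, ∑ j ∈ Finset.univ.filter (fun j => G.Adj i j), (1 - ((z j / z i : Circle) : ℂ).re)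

/-- The point of the torus with phases `u`. -/
def toTorus {n : ℕ} (u : Fin n → ℝ) : Fin n → Circle := fun i => Circle.exp (u i)

/-! ### Stability -/

/-- `v` solves `dv/dt = F v` on `[0, ∞)`. -/
def IsSolution {n : ℕ} (F : (Fin n → ℝ) → (Fin n → ℝ)) (v : ℝ → Fin n → ℝ) : Prop :=
  ∀ t : ℝ, 0 ≤ t → HasDerivWithinAt v (F (v t)) (Set.Ici 0) t

/-- `u` is an asymptotically stable equilibrium of `dv/dt = F v` restricted to the invariant
affine hyperplane `{w : ∑ w_i = ∑ u_i}` through `u`: it is an equilibrium, it is Lyapunov stable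
and it attracts all solutions that start near it in that hyperplane. -/
def IsAsymptoticallyStableEquilibrium {n : ℕ} (F : (Fin n → ℝ) → (Fin n → ℝ))
    (u : Fin n → ℝ) : Prop :=
  F u = 0 ∧
  (∀ r > 0, ∃ δ > 0, ∀ v : ℝ → Fin n → ℝ, IsSolution F v → ∑ i, v 0 i = ∑ i, u i →
    dist (v 0) u < δ → ∀ t : ℝ, 0 ≤ t → dist (v t) u < r) ∧
  (∃ δ > 0, ∀ v : ℝ → Fin n → ℝ, IsSolution F v → ∑ i, v 0 i = ∑ i, u i →
    dist (v 0) u < δ → Tendsto v atTop (𝓝 u))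

/-! ### The index (winding number) on the torus

The label that follows `j` cyclically is `finRotate n j`, that is `j + 1` modulo `n`. -/

/-- The geodesic from `a` to `b` in the circle, on `[0, 1]` (the unique one when `b ≠ -a`). -/
def geodesic (a b : Circle) (t : ℝ) : ℂ :=
  (a : ℂ) * Complex.exp ((t * Complex.arg ((b / a : Circle) : ℂ) : ℝ) * Complex.I)

/-- The index `(2πi)⁻¹ ∫ dz / z` of the closed curve that concatenates the geodesics from each
`z_j` to the next point. -/
def index {n : ℕ} (z : Fin n → Circle) : ℂ :=
  (2 * Real.pi * Complex.I)⁻¹ * ∑ j, ∫ t in (0 : ℝ)..1,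
    deriv (geodesic (z j) (z (finRotate n j))) t / geodesic (z j) (z (finRotate n j)) t

/-- The points of the torus for which no two cyclically consecutive coordinates are antipodal,
so that the index is well defined. -/
def indexDomain (n : ℕ) : Set (Fin n → Circle) :=
  {z | ∀ j, (z (finRotate n j) : ℂ) ≠ -(z j : ℂ)}

/-- The set `K_q` of the points of the torus of index `q`. -/
def K (n : ℕ) (q : ℤ) : Set (Fin n → Circle) :=
  {z | z ∈ indexDomain n ∧ index z = (q : ℂ)}

/-! ### Events of probability tending to one -/

/-- The probability of `A n` tends to one. The second clause follows from the first when the sets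
are measurable, and otherwise makes the inner probability tend to one as well. -/
def WithHighProbability {Ω : ℕ → Type*} [∀ n, MeasurableSpace (Ω n)]
    (P : ∀ n, Measure (Ω n)) (A : ∀ n, Set (Ω n)) : Prop :=
  Tendsto (fun n => P n (A n)) atTop (𝓝 1) ∧ Tendsto (fun n => P n (A n)ᶜ) atTop (𝓝 0)

end Kuramoto

end

namespace Kuramoto

/-! The twisted state `z_j = x_j ^ q` has index `q`, and its energy is so small that a minimiser
over the closure of `K_q` cannot reach the boundary.

Measure energy by `chordEnergy`, the sum of squared chords over oriented edges. Up to an event of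
probability `28 / n` (`measure_irregular_le_div`, by Chernoff bounds over about `4π / ε` arcs),
every arc of length slightly below `ε / 2` holds at least of order `nε` nodes and every degree is at
most `6nε`. Hence the twisted state has chord energy at most `6 n² ε³ q²`. Conversely, the endpoints
of an edge have of order `nε` common neighbours, and the triangle inequality through each of them
(`card_mul_dist_sq_le`) bounds the squared chord of the edge by a constant times the chord energy
divided by `nε`. For a minimiser this is of order `q² n ε²`, which tends to zero; this is where `n
ε² → 0` enters.

So every edge of a minimiser has a chord shorter than `√2`, that is, a phase difference of positive
cosine. Cyclic neighbours are adjacent, hence not antipodal. The index is locally constant where it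
is defined, so the minimiser lies in the open set `K_q` and its phases are an equilibrium. Positive
cosines on the edges of a connected graph make the field contract towards it transversally to the
constants (`exists_contraction`), which gives asymptotic stability (`stable_of_isMinOn`). -/

/-! ### Summation by parts and the Poincaré inequality on a graph -/

open Classical in
theorem sum_adj_comm {n : ℕ} (G : SimpleGraph (Fin n)) (g : Fin n → Fin n → ℝ) :
    ∑ i, ∑ j ∈ Finset.univ.filter (fun j => G.Adj i j), g i j =
      ∑ i, ∑ j ∈ Finset.univ.filter (fun j => G.Adj i j), g j i := by
  simp only [Finset.sum_filter]
  rw [Finset.sum_comm]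
  simp only [G.adj_comm]

open Classical in
/-- Summation by parts on a graph. -/
theorem sum_mul_sum_adj {n : ℕ} (G : SimpleGraph (Fin n)) (w : Fin n → ℝ)
    (f : Fin n → Fin n → ℝ) (hf : ∀ i j, f j i = -f i j) :
    ∑ i, w i * ∑ j ∈ Finset.univ.filter (fun j => G.Adj i j), f i j =
      -(1 / 2) * ∑ i, ∑ j ∈ Finset.univ.filter (fun j => G.Adj i j), (w j - w i) * f i j := by
  have h := sum_adj_comm G (fun i j => w j * f i j)
  have h' : ∑ i, ∑ j ∈ Finset.univ.filter (fun j => G.Adj i j), w i * f j i =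
      -∑ i, ∑ j ∈ Finset.univ.filter (fun j => G.Adj i j), w i * f i j := by
    simp only [← Finset.sum_neg_distrib]
    exact Finset.sum_congr rfl fun i _ => Finset.sum_congr rfl fun j _ => by rw [hf i j, mul_neg]
  simp only [sub_mul, Finset.sum_sub_distrib, Finset.mul_sum _ _ (w _)]
  linarith

open Classical in
/-- The Dirichlet form of a graph. -/
noncomputable def dirichlet {n : ℕ} (G : SimpleGraph (Fin n)) (w : Fin n → ℝ) : ℝ :=
  ∑ i, ∑ j ∈ Finset.univ.filter (fun j => G.Adj i j), (w j - w i) ^ 2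

theorem dirichlet_nonneg {n : ℕ} (G : SimpleGraph (Fin n)) (w : Fin n → ℝ) :
    0 ≤ dirichlet G w :=
  Finset.sum_nonneg fun _ _ => Finset.sum_nonneg fun _ _ => sq_nonneg _

theorem sq_sub_le_dirichlet {n : ℕ} {G : SimpleGraph (Fin n)} {i j : Fin n} (h : G.Adj i j)
    (w : Fin n → ℝ) : (w j - w i) ^ 2 ≤ dirichlet G w := by
  classical
  unfold dirichlet
  refine le_trans ?_ (Finset.single_le_sum (fun a _ => Finset.sum_nonneg fun _ _ => sq_nonneg _)
    (Finset.mem_univ i))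
  exact Finset.single_le_sum (f := fun j => (w j - w i) ^ 2) (fun _ _ => sq_nonneg _)
    (by simpa using h)

theorem exists_sq_sub_le_of_reachable {n : ℕ} {G : SimpleGraph (Fin n)} {i j : Fin n}
    (h : G.Reachable i j) :
    ∃ C : ℝ, 0 ≤ C ∧ ∀ w : Fin n → ℝ, (w j - w i) ^ 2 ≤ C * dirichlet G w := by
  obtain ⟨p⟩ := h
  induction p with
  | nil => exact ⟨0, le_rfl, fun w => by simp⟩
  | cons hadj p ih =>
    obtain ⟨C, hC, h⟩ := ih
    -- From `(a + b)² ≤ 2a² + 2b²`, with one edge prepended to the walk.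
    refine ⟨2 * C + 2, by positivity, fun w => ?_⟩
    have h1 := h w
    have h2 := sq_sub_le_dirichlet hadj w
    rename_i a b c
    nlinarith [sq_nonneg ((w c - w b) - (w b - w a))]

theorem sum_sum_sub_sq {n : ℕ} (w : Fin n → ℝ) (hw : ∑ i, w i = 0) :
    ∑ i, ∑ j, (w j - w i) ^ 2 = 2 * n * ∑ i, w i ^ 2 := by
  have : ∀ i j, (w j - w i) ^ 2 = w j ^ 2 - 2 * (w i * w j) + w i ^ 2 := fun i j => by ring
  simp only [this, Finset.sum_add_distrib, Finset.sum_sub_distrib, ← Finset.mul_sum, hw]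
  simp
  rw [← Finset.mul_sum]; ring

/-- The Poincaré inequality on a connected graph. -/
theorem exists_poincare {n : ℕ} (hn : 0 < n) {G : SimpleGraph (Fin n)} (hG : G.Preconnected) :
    ∃ C : ℝ, 0 < C ∧ ∀ w : Fin n → ℝ, ∑ i, w i = 0 → ∑ i, w i ^ 2 ≤ C * dirichlet G w := by
  choose C hC0 hC using fun i j => exists_sq_sub_le_of_reachable (hG i j)
  refine ⟨∑ i, ∑ j, C i j + 1, ?_, fun w hw => ?_⟩
  · have : 0 ≤ ∑ i, ∑ j, C i j := Finset.sum_nonneg fun i _ => Finset.sum_nonneg fun j _ => hC0 i j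
    linarith
  · have h1 : ∑ i, ∑ j, (w j - w i) ^ 2 ≤ (∑ i, ∑ j, C i j) * dirichlet G w := by
      simp only [Finset.sum_mul]
      exact Finset.sum_le_sum fun i _ => Finset.sum_le_sum fun j _ => hC i j w
    rw [sum_sum_sub_sq w hw] at h1
    have h2 : (1 : ℝ) ≤ n := by exact_mod_cast hn
    have h3 : 0 ≤ ∑ i, w i ^ 2 := Finset.sum_nonneg fun _ _ => sq_nonneg _
    have h4 := dirichlet_nonneg G w
    nlinarith

/-! ### Contraction near an equilibrium and asymptotic stability -/

/-- Strong monotonicity of the sine near an angle of positive cosine. -/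
theorem mul_sin_sub_sin_ge {a d : ℝ} (h : |d| ≤ Real.cos a / 4) :
    Real.cos a / 4 * d ^ 2 ≤ d * (Real.sin (a + d) - Real.sin a) := by
  have hc1 := Real.cos_le_one a
  have hs := Real.abs_sin_le_one a
  have hd1 : |d| ≤ 1 := by linarith
  have h0 : 0 ≤ Real.cos a := by have := abs_nonneg d; linarith
  -- By the addition formula the right-hand side is `cos a · d sin d - d sin a · (1 - cos d)`. The
  -- first term is at least `cos a · d² / 2`; the second is at most `|d|³ / 2 ≤ cos a · d² / 8`.
  have h1 : d ^ 2 / 2 ≤ d * Real.sin d := by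
    have h2π : (1 : ℝ) / 2 ≤ 2 / Real.pi := by
      rw [div_le_div_iff₀ two_pos Real.pi_pos]; linarith [Real.pi_le_four]
    have hlin : ∀ x : ℝ, 0 ≤ x → x ≤ 1 → x / 2 ≤ Real.sin x := fun x hx hx1 => by
      have := Real.mul_le_sin hx (by linarith [Real.pi_gt_three])
      nlinarith
    rcases le_total 0 d with hd | hd
    · have := hlin d hd (by rwa [abs_of_nonneg hd] at hd1)
      nlinarith
    · have := hlin (-d) (by linarith) (by rwa [abs_of_nonpos hd] at hd1)
      rw [Real.sin_neg] at this
      nlinarith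
  have h2 : 1 - Real.cos d ≤ d ^ 2 / 2 := by linarith [Real.one_sub_sq_div_two_le_cos (x := d)]
  have h3 : |d * Real.sin a * (1 - Real.cos d)| ≤ |d| * (d ^ 2 / 2) := by
    rw [abs_mul, abs_mul, abs_of_nonneg (by linarith [Real.cos_le_one d] : 0 ≤ 1 - Real.cos d)]
    have := Real.cos_le_one d
    have h5 : |d| * |Real.sin a| ≤ |d| := mul_le_of_le_one_right (abs_nonneg d) hs
    exact mul_le_mul h5 h2 (by linarith) (abs_nonneg d)
  have h4 := le_abs_self (d * Real.sin a * (1 - Real.cos d))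
  rw [Real.sin_add]
  nlinarith [mul_le_mul_of_nonneg_left h1 h0, mul_le_mul_of_nonneg_right h (sq_nonneg d)]

theorem field_add_const {n : ℕ} (G : SimpleGraph (Fin n)) (ε : ℝ) (u : Fin n → ℝ) (c : ℝ) :
    field G ε (fun i => u i + c) = field G ε u := by
  unfold field; simp

theorem sum_mul_field {n : ℕ} (G : SimpleGraph (Fin n)) (ε : ℝ) (w u : Fin n → ℝ) :
    ∑ i, w i * field G ε u i = -(Real.pi / (2 * (n : ℝ) ^ 2 * ε ^ 3)) *
      ∑ i, ∑ j ∈ @Finset.filter _ (fun j => G.Adj i j) (Classical.decPred _) Finset.univ,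
        (w j - w i) * Real.sin (u j - u i) := by
  classical
  have := sum_mul_sum_adj G w (fun i j => Real.sin (u j - u i))
    (fun i j => by rw [← Real.sin_neg, neg_sub])
  unfold field
  simp only [mul_left_comm (w _)]
  rw [← Finset.mul_sum]
  rw [show Real.pi / (2 * (n : ℝ) ^ 2 * ε ^ 3) = Real.pi / ((n : ℝ) ^ 2 * ε ^ 3) * (1 / 2) by
    rw [mul_assoc, ← div_div, div_right_comm]; ring]
  convert congrArg (fun x => Real.pi / ((n : ℝ) ^ 2 * ε ^ 3) * x) this using 1
  ring_nf

theorem sum_field {n : ℕ} (G : SimpleGraph (Fin n)) (ε : ℝ) (u : Fin n → ℝ) :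
    ∑ i, field G ε u i = 0 := by
  have := sum_mul_field G ε (fun _ => 1) u
  simpa using this

/-- The field is a strict contraction towards an equilibrium whose edges have phase differences of
positive cosine. -/
theorem exists_contraction {n : ℕ} (hn : 0 < n) {G : SimpleGraph (Fin n)} {ε : ℝ} (hε : 0 < ε)
    (hG : G.Preconnected) {u : Fin n → ℝ}
    (hcos : ∀ i j, G.Adj i j → 0 < Real.cos (u j - u i)) (hF : field G ε u = 0) :
    ∃ ρ > 0, ∃ κ > 0, ∀ v : Fin n → ℝ, ∑ i, v i = ∑ i, u i → ∑ i, (v i - u i) ^ 2 ≤ ρ →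
      ∑ i, (v i - u i) * field G ε v i ≤ -κ * ∑ i, (v i - u i) ^ 2 := by
  classical
  obtain ⟨C, hC, hP⟩ := exists_poincare hn hG
  obtain ⟨c, hc, hcle⟩ : ∃ c > 0, ∀ i j, G.Adj i j → c ≤ Real.cos (u j - u i) := by
    have : ∀ᶠ c in 𝓝[>] (0 : ℝ), ∀ p : Fin n × Fin n, G.Adj p.1 p.2 →
        c ≤ Real.cos (u p.2 - u p.1) := by
      rw [Filter.eventually_all]
      rintro ⟨i, j⟩
      by_cases h : G.Adj i j
      · filter_upwards [mem_nhdsWithin_of_mem_nhds (Iio_mem_nhds (hcos i j h))] with c hc _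
        exact le_of_lt hc
      · exact Filter.Eventually.of_forall fun c h' => absurd h' h
    obtain ⟨c, hc, hc0⟩ := (this.and self_mem_nhdsWithin).exists
    exact ⟨c, hc0, fun i j h => hc (i, j) h⟩
  set A := Real.pi / (2 * (n : ℝ) ^ 2 * ε ^ 3) with hA
  have hApos : 0 < A := by
    have : (0 : ℝ) < n := by exact_mod_cast hn
    have := Real.pi_pos
    positivity
  -- Phases moved by at most `c / 8` change differences by at most `c / 4`, the range of
  -- `mul_sin_sub_sin_ge`. The rate combines its constant `c / 4` with the Poincaré constant `C`.
  refine ⟨(c / 8) ^ 2, by positivity, A * (c / 4) / C, by positivity, fun v hv hvρ => ?_⟩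
  have h0 : ∑ i, (v i - u i) * field G ε u i = 0 := by simp [hF]
  rw [← sub_zero (∑ i, (v i - u i) * field G ε v i), ← h0, sum_mul_field, sum_mul_field, ← mul_sub]
  have hw : ∀ i, |v i - u i| ≤ c / 8 := fun i => by
    rw [← Real.sqrt_sq_eq_abs]
    refine Real.sqrt_le_iff.2 ⟨by positivity, le_trans ?_ hvρ⟩
    exact Finset.single_le_sum (f := fun i => (v i - u i) ^ 2) (fun _ _ => sq_nonneg _)
      (Finset.mem_univ i)
  have key : c / 4 * dirichlet G (fun i => v i - u i) ≤
      ∑ i, ∑ j ∈ Finset.univ.filter (fun j => G.Adj i j),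
        ((v j - u j) - (v i - u i)) * Real.sin (v j - v i) -
      ∑ i, ∑ j ∈ Finset.univ.filter (fun j => G.Adj i j),
        ((v j - u j) - (v i - u i)) * Real.sin (u j - u i) := by
    unfold dirichlet
    rw [Finset.mul_sum, ← Finset.sum_sub_distrib]
    refine Finset.sum_le_sum fun i _ => ?_
    rw [Finset.mul_sum, ← Finset.sum_sub_distrib]
    refine Finset.sum_le_sum fun j hj => ?_
    have hadj : G.Adj i j := by simpa using hj
    rw [← mul_sub]
    have h1 := hcle i j hadj
    have h2 := mul_sin_sub_sin_ge (a := u j - u i) (d := (v j - u j) - (v i - u i)) (by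
      have := abs_sub (v j - u j) (v i - u i)
      linarith [hw i, hw j])
    rw [show u j - u i + (v j - u j - (v i - u i)) = v j - v i by ring] at h2
    refine le_trans ?_ h2
    gcongr
  have hP' := hP (fun i => v i - u i) (by simp [Finset.sum_sub_distrib, hv])
  have h5 : A * (c / 4) / C * ∑ i, (v i - u i) ^ 2 ≤
      A * (c / 4 * dirichlet G (fun i => v i - u i)) := by
    rw [div_mul_eq_mul_div, div_le_iff₀ hC]
    calc A * (c / 4) * ∑ i, (v i - u i) ^ 2 ≤ A * (c / 4) * (C * dirichlet G fun i => v i - u i) := by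
          gcongr
      _ = _ := by ring
  have h6 := mul_le_mul_of_nonneg_left key hApos.le
  linarith

/-- The squared Euclidean distance to `u` is a strict Lyapunov function on the hyperplane, which
solutions do not leave because the field has zero sum. -/
theorem isAsymptoticallyStableEquilibrium_of_cos_pos {n : ℕ} (hn : 0 < n) {G : SimpleGraph (Fin n)}
    {ε : ℝ} (hε : 0 < ε) (hG : G.Preconnected) {u : Fin n → ℝ}
    (hcos : ∀ i j, G.Adj i j → 0 < Real.cos (u j - u i)) (hF : field G ε u = 0) :
    IsAsymptoticallyStableEquilibrium (field G ε) u := by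
  obtain ⟨ρ, hρ, κ, hκ, hcon⟩ := exists_contraction hn hε hG hcos hF
  have decay : ∀ v : ℝ → Fin n → ℝ, IsSolution (field G ε) v → ∑ i, v 0 i = ∑ i, u i →
      ∀ A, 0 < A → A ≤ ρ → ∑ i, (v 0 i - u i) ^ 2 ≤ A → ∀ t, 0 ≤ t →
      ∑ i, (v t i - u i) ^ 2 ≤ A * Real.exp (-κ * t) := by
    intro v hv hsum A hA hAρ h0 t ht
    have hd : ∀ s, 0 ≤ s → ∀ i, HasDerivWithinAt (fun t => v t i) (field G ε (v s) i)
        (Set.Ici s) s := fun s hs i =>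
      ((hasDerivWithinAt_pi.1 (hv s hs)) i).mono (Set.Ici_subset_Ici.2 hs)
    have hcv : ∀ i, ContinuousOn (fun t => v t i) (Set.Icc 0 t) := fun i s hs =>
      ((hasDerivWithinAt_pi.1 (hv s hs.1)) i).continuousWithinAt.mono Set.Icc_subset_Ici_self
    have hs : ∀ s ∈ Set.Icc 0 t, ∑ i, v s i = ∑ i, u i := by
      intro s hs
      rw [← hsum]
      refine constant_of_has_deriv_right_zero (f := fun s => ∑ i, v s i)
        (continuousOn_finsetSum _ fun i _ => hcv i) (fun x hx => ?_) s hs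
      rw [← sum_field G ε (v x)]
      exact HasDerivWithinAt.fun_sum fun i _ => hd x hx.1 i
    -- The contraction gives decay at rate `2κ`; the barrier decays only at rate `κ`, so the
    -- inequality of derivatives at a contact point is strict. The contraction applies there since
    -- the barrier stays below `A ≤ ρ`.
    refine image_le_of_deriv_right_lt_deriv_boundary (f := fun t => ∑ i, (v t i - u i) ^ 2)
      (f' := fun t => ∑ i, 2 * (v t i - u i) * field G ε (v t) i)
      (B := fun t => A * Real.exp (-κ * t)) (B' := fun t => A * (Real.exp (-κ * t) * -κ))
      (continuousOn_finsetSum _ fun i _ => ((hcv i).sub continuousOn_const).pow 2)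
      (fun x hx => HasDerivWithinAt.fun_sum fun i _ => ?_) (by simpa using h0) (fun x => ?_)
      (fun x hx heq => ?_) ⟨ht, le_rfl⟩
    · simpa using ((hd x hx.1 i).sub_const (u i)).fun_pow 2
    · refine HasDerivAt.const_mul A (HasDerivAt.exp ?_)
      simpa only [mul_one] using (hasDerivAt_id' x).const_mul (-κ)
    · have hexp : Real.exp (-κ * x) ≤ 1 := Real.exp_le_one_iff.2 (by nlinarith [hx.1])
      have hB : 0 < A * Real.exp (-κ * x) := by positivity
      have h1 := hcon (v x) (hs x ⟨hx.1, hx.2.le⟩) (by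
        rw [heq]; nlinarith)
      have h2 : ∑ i, 2 * (v x i - u i) * field G ε (v x) i =
          2 * ∑ i, (v x i - u i) * field G ε (v x) i := by
        rw [Finset.mul_sum]; exact Finset.sum_congr rfl fun i _ => by ring
      rw [h2]
      rw [heq] at h1
      nlinarith
  have hn' : (0 : ℝ) < n := by exact_mod_cast hn
  have hball : ∀ w : Fin n → ℝ, ∀ δ > 0, dist w u < δ → ∑ i, (w i - u i) ^ 2 ≤ n * δ ^ 2 := by
    intro w δ hδ h
    calc ∑ i, (w i - u i) ^ 2 ≤ ∑ _i : Fin n, δ ^ 2 := Finset.sum_le_sum fun i _ => by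
          rw [← sq_abs, ← Real.dist_eq]
          have := (dist_le_pi_dist w u i).trans h.le
          gcongr
      _ = n * δ ^ 2 := by simp
  have hdist : ∀ w : Fin n → ℝ, ∀ B : ℝ, ∑ i, (w i - u i) ^ 2 ≤ B → dist w u ≤ Real.sqrt B := by
    intro w B h
    refine (dist_pi_le_iff (Real.sqrt_nonneg _)).2 fun i => ?_
    rw [Real.dist_eq]
    refine Real.abs_le_sqrt (le_trans ?_ h)
    exact Finset.single_le_sum (f := fun i => (w i - u i) ^ 2) (fun _ _ => sq_nonneg _)
      (Finset.mem_univ i)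
  refine ⟨hF, fun r hr => ?_, ?_⟩
  · have hA : 0 < min ρ (r ^ 2 / 4) := by positivity
    refine ⟨Real.sqrt (min ρ (r ^ 2 / 4) / n), by positivity, fun v hv hsum h t ht => ?_⟩
    have h1 := hball _ _ (by positivity) h
    rw [Real.sq_sqrt (by positivity), mul_div_cancel₀ _ hn'.ne'] at h1
    have h2 := decay v hv hsum _ hA (min_le_left _ _) h1 t ht
    have h3 : ∑ i, (v t i - u i) ^ 2 ≤ (r / 2) ^ 2 := by
      have : Real.exp (-κ * t) ≤ 1 := Real.exp_le_one_iff.2 (by nlinarith)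
      have h4 := min_le_right ρ (r ^ 2 / 4)
      nlinarith
    have h5 := hdist _ _ h3
    rw [Real.sqrt_sq (by positivity)] at h5
    linarith
  · refine ⟨Real.sqrt (ρ / n), by positivity, fun v hv hsum h => ?_⟩
    have h1 := hball _ _ (by positivity) h
    rw [Real.sq_sqrt (by positivity), mul_div_cancel₀ _ hn'.ne'] at h1
    rw [tendsto_iff_dist_tendsto_zero]
    have hlim : Tendsto (fun t => Real.sqrt (ρ * Real.exp (-κ * t))) atTop (𝓝 0) := by
      have : Tendsto (fun t => ρ * Real.exp (-κ * t)) atTop (𝓝 (ρ * 0)) := by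
        refine Tendsto.const_mul ρ (Real.tendsto_exp_atBot.comp ?_)
        exact tendsto_id.const_mul_atTop_of_neg (by linarith)
      have h2 := (Real.continuous_sqrt.tendsto _).comp this
      rwa [mul_zero, Real.sqrt_zero] at h2
    refine squeeze_zero' (Eventually.of_forall fun _ => dist_nonneg) ?_ hlim
    filter_upwards [eventually_ge_atTop 0] with t ht
    exact hdist _ _ (decay v hv hsum ρ hρ le_rfl h1 t ht)

/-! ### The index: integrality, local constancy and the topology of `K_q` -/

/-- The sum of the signed angles between cyclically consecutive coordinates. -/
noncomputable def argSum {n : ℕ} (z : Fin n → Circle) : ℝ :=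
  ∑ j, Complex.arg ((z (finRotate n j) / z j : Circle) : ℂ)

theorem integral_geodesic (a b : Circle) :
    ∫ t in (0 : ℝ)..1, deriv (geodesic a b) t / geodesic a b t =
      Complex.arg ((b / a : Circle) : ℂ) * Complex.I := by
  set θ := Complex.arg ((b / a : Circle) : ℂ) with hθ
  have hd : ∀ t : ℝ, HasDerivAt (geodesic a b) (geodesic a b t * (θ * Complex.I)) t := by
    intro t
    have h1 : HasDerivAt (fun t : ℝ => ((t * θ : ℝ) : ℂ) * Complex.I) (θ * Complex.I) t := by
      refine HasDerivAt.mul_const ?_ _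
      have := ((hasDerivAt_id' t).mul_const θ).ofReal_comp
      simpa only [one_mul] using this
    have := (h1.cexp).const_mul (a : ℂ)
    rw [← mul_assoc] at this
    exact this
  have hne : ∀ t, geodesic a b t ≠ 0 := fun t =>
    mul_ne_zero (Circle.coe_ne_zero a) (Complex.exp_ne_zero _)
  have : ∀ t, deriv (geodesic a b) t / geodesic a b t = θ * Complex.I := fun t => by
    rw [(hd t).deriv, mul_div_cancel_left₀ _ (hne t)]
  simp only [this]
  simp

theorem index_eq {n : ℕ} (z : Fin n → Circle) :
    index z = (((2 * Real.pi)⁻¹ * argSum z : ℝ) : ℂ) := by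
  unfold index argSum
  simp only [integral_geodesic, ← Finset.sum_mul]
  push_cast
  have := Complex.I_ne_zero
  field_simp

theorem index_eq_intCast_iff {n : ℕ} (z : Fin n → Circle) (q : ℤ) :
    index z = q ↔ argSum z = q * (2 * Real.pi) := by
  rw [index_eq, show (q : ℂ) = ((q : ℝ) : ℂ) by simp, Complex.ofReal_inj,
    inv_mul_eq_iff_eq_mul₀ (by positivity), mul_comm]

/-- The exponential of the sum is the product of the successive quotients, which telescopes around
the cycle to `1`. -/
theorem exists_argSum_eq {n : ℕ} (z : Fin n → Circle) : ∃ m : ℤ, argSum z = m * (2 * Real.pi) := by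
  have : Circle.exp (argSum z) = 1 := by
    unfold argSum
    have hprod : ∀ s : Finset (Fin n), Circle.exp
        (∑ j ∈ s, Complex.arg ((z (finRotate n j) / z j : Circle) : ℂ)) =
        ∏ j ∈ s, z (finRotate n j) / z j := fun s => by
      classical
      induction s using Finset.induction_on with
      | empty => simp
      | insert a s ha ih => rw [Finset.sum_insert ha, Finset.prod_insert ha, Circle.exp_add, ih,
          Circle.exp_arg]
    rw [hprod, Finset.prod_div_distrib, Equiv.prod_comp, div_self']
  obtain ⟨m, hm⟩ := Circle.exp_eq_one.1 this
  exact ⟨m, hm⟩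

theorem mem_slitPlane_of_ne_neg_one {w : Circle} (h : (w : ℂ) ≠ -1) :
    (w : ℂ) ∈ Complex.slitPlane := by
  rw [Complex.mem_slitPlane_iff]
  by_contra hc
  push Not at hc
  have h1 : (w : ℂ).re ^ 2 + (w : ℂ).im ^ 2 = 1 := by
    have := Circle.normSq_coe w
    rw [Complex.normSq_apply] at this
    linarith
  rw [hc.2] at h1
  have h2 : (w : ℂ).re = -1 := by nlinarith [hc.1]
  exact h (Complex.ext (by simpa using h2) (by simpa using hc.2))

theorem isOpen_indexDomain (n : ℕ) : IsOpen (indexDomain n) := by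
  unfold indexDomain
  simp only [Set.ofPred_forall]
  exact isOpen_iInter_of_finite fun j => isOpen_ne_fun (by fun_prop) (by fun_prop)

theorem continuousAt_argSum {n : ℕ} {z : Fin n → Circle} (hz : z ∈ indexDomain n) :
    ContinuousAt argSum z := by
  unfold argSum
  refine tendsto_finsetSum _ fun j _ => ?_
  have h1 : ((z (finRotate n j) / z j : Circle) : ℂ) ∈ Complex.slitPlane := by
    refine mem_slitPlane_of_ne_neg_one fun h => hz j ?_
    rw [Circle.coe_div, div_eq_iff (Circle.coe_ne_zero _)] at h
    rw [h, neg_one_mul]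
  refine (Complex.continuousAt_arg h1).tendsto.comp (f := fun z : Fin n → Circle =>
    ((z (finRotate n j) / z j : Circle) : ℂ)) ?_
  have : Continuous (fun z : Fin n → Circle => ((z (finRotate n j) / z j : Circle) : ℂ)) :=
    continuous_induced_dom.comp ((continuous_apply _).div' (continuous_apply _))
  exact this.tendsto z

/-- A continuous function with values in `2πℤ` is locally constant; a variation below `π` already
forces equality. -/
theorem eventually_argSum_eq {n : ℕ} {z : Fin n → Circle} (hz : z ∈ indexDomain n) :
    ∀ᶠ z' in 𝓝 z, z' ∈ indexDomain n ∧ argSum z' = argSum z := by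
  filter_upwards [(isOpen_indexDomain n).mem_nhds hz,
    (continuousAt_argSum hz).tendsto (Metric.ball_mem_nhds _ Real.pi_pos)] with z' h1 h2
  refine ⟨h1, ?_⟩
  obtain ⟨m, hm⟩ := exists_argSum_eq z
  obtain ⟨m', hm'⟩ := exists_argSum_eq z'
  rw [Set.mem_preimage, Metric.mem_ball, Real.dist_eq, hm, hm', ← sub_mul, abs_mul,
    abs_of_pos Real.two_pi_pos] at h2
  have h3 : |(m' : ℝ) - m| < 1 := by
    by_contra hc
    nlinarith [Real.pi_pos]
  have h4 : m' = m := by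
    have : |m' - m| < 1 := by exact_mod_cast h3
    rw [Int.abs_lt_one_iff] at this
    omega
  rw [hm, hm', h4]

theorem isOpen_K (n : ℕ) (q : ℤ) : IsOpen (K n q) := by
  rw [isOpen_iff_mem_nhds]
  rintro z ⟨hz, hq⟩
  filter_upwards [eventually_argSum_eq hz] with z' h
  refine ⟨h.1, ?_⟩
  rw [index_eq_intCast_iff] at hq ⊢
  rw [h.2, hq]

/-- The index cannot jump inside the domain, so `K_q` is left in its closure only through antipodal
consecutive coordinates. -/
theorem mem_K_of_mem_closure {n : ℕ} {q : ℤ} {z : Fin n → Circle} (h : z ∈ closure (K n q))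
    (hz : z ∈ indexDomain n) : z ∈ K n q := by
  obtain ⟨z', h1, h2⟩ := (mem_closure_iff_frequently.1 h).and_eventually
    (eventually_argSum_eq hz) |>.exists
  refine ⟨hz, ?_⟩
  have := h1.2
  rw [index_eq_intCast_iff] at this ⊢
  rw [← h2.2, this]

/-! ### The energy as a sum of squared chords -/

open Classical in
/-- The sum of the squared chord lengths over the (oriented) edges. -/
noncomputable def chordEnergy {n : ℕ} (G : SimpleGraph (Fin n)) (z : Fin n → Circle) : ℝ :=
  ∑ i, ∑ j ∈ Finset.univ.filter (fun j => G.Adj i j), dist (z j) (z i) ^ 2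

theorem re_div_eq (a b : Circle) : ((a / b : Circle) : ℂ).re = 1 - dist a b ^ 2 / 2 := by
  have h : dist a b = ‖((a / b : Circle) : ℂ) - 1‖ := by
    rw [show dist a b = ‖(a : ℂ) - b‖ from dist_eq_norm (a : ℂ) b, Circle.coe_div]
    rw [div_sub_one (Circle.coe_ne_zero b), norm_div, Circle.norm_coe, div_one]
  have h1 : ((a / b : Circle) : ℂ).re ^ 2 + ((a / b : Circle) : ℂ).im ^ 2 = 1 := by
    have := Circle.normSq_coe (a / b)
    rw [Complex.normSq_apply] at this
    linarith
  rw [h, Complex.sq_norm, Complex.normSq_apply]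
  simp only [Complex.sub_re, Complex.sub_im, Complex.one_re, Complex.one_im]
  linarith

theorem energy_eq_chordEnergy {n : ℕ} (G : SimpleGraph (Fin n)) (ε : ℝ) (z : Fin n → Circle) :
    energy G ε z = Real.pi / (2 * (n : ℝ) ^ 2 * ε ^ 3) * (chordEnergy G z / 2) := by
  unfold energy chordEnergy
  simp only [re_div_eq, sub_sub_cancel, ← Finset.sum_div]

theorem chordEnergy_le_of_energy_le {n : ℕ} (hn : 0 < n) {G : SimpleGraph (Fin n)} {ε : ℝ}
    (hε : 0 < ε) {z z' : Fin n → Circle} (h : energy G ε z ≤ energy G ε z') :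
    chordEnergy G z ≤ chordEnergy G z' := by
  have : (0 : ℝ) < n := by exact_mod_cast hn
  have hA : 0 < Real.pi / (2 * (n : ℝ) ^ 2 * ε ^ 3) := by positivity
  rw [energy_eq_chordEnergy, energy_eq_chordEnergy, mul_le_mul_iff_right₀ hA] at h
  linarith

theorem continuous_energy {n : ℕ} (G : SimpleGraph (Fin n)) (ε : ℝ) : Continuous (energy G ε) := by
  rw [show energy G ε = _ from funext (energy_eq_chordEnergy G ε)]
  unfold chordEnergy
  fun_prop

/-- The chord between adjacent nodes is short when the energy is small compared with the number
of common neighbours. -/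
theorem card_mul_dist_sq_le {n : ℕ} (G : SimpleGraph (Fin n)) (z : Fin n → Circle) {i j : Fin n}
    (hij : i ≠ j) (T : Finset (Fin n))
    (hT : ∀ k ∈ T, (k = i ∨ G.Adj i k) ∧ (k = j ∨ G.Adj j k)) :
    T.card * dist (z i) (z j) ^ 2 ≤ 2 * chordEnergy G z := by
  classical
  have hrow : ∀ a : Fin n, (∀ k ∈ T, k = a ∨ G.Adj a k) → ∑ k ∈ T, dist (z k) (z a) ^ 2 ≤
      ∑ k ∈ Finset.univ.filter (fun k => G.Adj a k), dist (z k) (z a) ^ 2 := by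
    intro a ha
    calc ∑ k ∈ T, dist (z k) (z a) ^ 2
        -- `T` may contain `a` itself, whose term vanishes.
        ≤ ∑ k ∈ insert a (Finset.univ.filter (fun k => G.Adj a k)), dist (z k) (z a) ^ 2 :=
          Finset.sum_le_sum_of_subset_of_nonneg (fun k hk => by simpa using ha k hk)
            fun _ _ _ => sq_nonneg _
      _ = _ := Finset.sum_insert_zero (by simp)
  calc (T.card : ℝ) * dist (z i) (z j) ^ 2 = ∑ _k ∈ T, dist (z i) (z j) ^ 2 := by simp
    _ ≤ ∑ k ∈ T, 2 * (dist (z k) (z i) ^ 2 + dist (z k) (z j) ^ 2) := by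
        refine Finset.sum_le_sum fun k _ => ?_
        have h1 := dist_triangle_left (z i) (z j) (z k)
        have h2 : dist (z i) (z j) ^ 2 ≤ (dist (z k) (z i) + dist (z k) (z j)) ^ 2 := by
          gcongr
        nlinarith [sq_nonneg (dist (z k) (z i) - dist (z k) (z j))]
    _ = 2 * (∑ k ∈ T, dist (z k) (z i) ^ 2 + ∑ k ∈ T, dist (z k) (z j) ^ 2) := by
        rw [← Finset.mul_sum, Finset.sum_add_distrib]
    -- The edges leaving `i` and those leaving `j` are distinct rows of the double sum, because `i ≠
    -- j`.
    _ ≤ 2 * ∑ a ∈ {i, j}, ∑ k ∈ Finset.univ.filter (fun k => G.Adj a k),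
          dist (z k) (z a) ^ 2 := by
        rw [Finset.sum_pair hij]
        exact mul_le_mul_of_nonneg_left (add_le_add (hrow i fun k hk => (hT k hk).1)
          (hrow j fun k hk => (hT k hk).2)) two_pos.le
    _ ≤ 2 * chordEnergy G z := by
        unfold chordEnergy
        gcongr
        exact Finset.subset_univ _

/-! ### Minimisers over the closure of `K_q` -/

theorem re_toTorus_div {n : ℕ} (u : Fin n → ℝ) (i j : Fin n) :
    ((toTorus u j / toTorus u i : Circle) : ℂ).re = Real.cos (u j - u i) := by
  unfold toTorus
  rw [← Circle.exp_sub, Circle.coe_exp, Complex.exp_ofReal_mul_I_re]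

/-- The phases of a local minimum of the energy are an equilibrium. -/
theorem field_eq_zero_of_isLocalMin {n : ℕ} (G : SimpleGraph (Fin n)) (ε : ℝ) (u : Fin n → ℝ)
    (h : IsLocalMin (energy G ε) (toTorus u)) : field G ε u = 0 := by
  classical
  set w := field G ε u with hw
  set A := Real.pi / (2 * (n : ℝ) ^ 2 * ε ^ 3) with hA
  -- The energy along the line through `u` in the direction of the field `w`; its derivative at `0`
  -- is `-∑ w_i²`.
  let φ : ℝ → ℝ := fun s => A * ∑ i, ∑ j ∈ Finset.univ.filter (fun j => G.Adj i j),
    (1 - Real.cos ((u j - u i) + s * (w j - w i)))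
  have hφ : φ = fun s => energy G ε (toTorus (fun i => u i + s * w i)) := by
    funext s
    simp only [φ, energy, re_toTorus_div]
    refine congrArg (A * ·) (Finset.sum_congr rfl fun i _ => Finset.sum_congr rfl fun j _ => ?_)
    ring_nf
  have hcont : ContinuousAt (fun s : ℝ => toTorus (fun i => u i + s * w i)) 0 := by
    unfold toTorus
    fun_prop
  have hmin : IsLocalMin φ 0 := by
    rw [hφ]
    have h0 : toTorus (fun i => u i + 0 * w i) = toTorus u := by simp
    have h1 : IsLocalMin (energy G ε) (toTorus (fun i => u i + 0 * w i)) := by rwa [h0]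
    exact IsMinFilter.comp_tendsto (g := fun s : ℝ => toTorus (fun i => u i + s * w i)) h1 hcont
  have hd : HasDerivAt φ (A * ∑ i, ∑ j ∈ Finset.univ.filter (fun j => G.Adj i j),
      (w j - w i) * Real.sin (u j - u i)) 0 := by
    refine HasDerivAt.const_mul A (HasDerivAt.fun_sum fun i _ => HasDerivAt.fun_sum fun j _ => ?_)
    have h1 : HasDerivAt (fun s : ℝ => (u j - u i) + s * (w j - w i)) (w j - w i) 0 := by
      simpa only [one_mul] using ((hasDerivAt_id' (0 : ℝ)).mul_const (w j - w i)).const_add _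
    have h2 := h1.cos.const_sub 1
    simp only [zero_mul, add_zero] at h2
    convert h2 using 1
    ring
  have h0 := hmin.hasDerivAt_eq_zero hd
  have h1 := sum_mul_field G ε w u
  have h2 : ∑ i, w i * w i = 0 := by
    rw [← neg_eq_zero, ← h0]
    conv_lhs => enter [1, 2, i]; rw [hw]
    rw [h1, neg_mul, neg_neg]
  rw [Finset.sum_eq_zero_iff_of_nonneg fun _ _ => mul_self_nonneg _] at h2
  funext i
  simpa using h2 i (Finset.mem_univ i)

theorem preconnected_of_adj_finRotate {n : ℕ} {G : SimpleGraph (Fin n)}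
    (h : ∀ j, G.Adj j (finRotate n j)) : G.Preconnected := by
  have key : ∀ k (hk : k < n), G.Reachable ⟨0, by omega⟩ ⟨k, hk⟩ := by
    intro k
    induction k with
    | zero => intro hk; rfl
    | succ k ih =>
      intro hk
      obtain ⟨n, rfl⟩ : ∃ m, n = m + 1 := ⟨n - 1, by omega⟩
      refine (ih (by omega)).trans ?_
      have := h ⟨k, by omega⟩
      rw [finRotate_of_lt (by omega)] at this
      exact this.reachable
  intro i j
  exact (key i i.2).symm.trans (key j j.2)

/-- Rotation invariance of the index, which allows the phases to be shifted to zero sum. -/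
theorem const_mul_mem_K {n : ℕ} {q : ℤ} {z : Fin n → Circle} (hz : z ∈ K n q) (c : Circle) :
    (fun i => c * z i) ∈ K n q := by
  refine ⟨fun j h => hz.1 j ?_, ?_⟩
  · simp only [Circle.coe_mul, ← mul_neg] at h
    exact mul_left_cancel₀ (Circle.coe_ne_zero c) h
  · have := hz.2
    rw [index_eq_intCast_iff] at this ⊢
    rw [← this]
    simp [argSum, mul_div_mul_left_eq_div]

/-- If every edge has many common neighbours and `K_q` contains a point of small energy, then every
minimiser of the energy over the closure of `K_q` lies in `K_q` and is a stable equilibrium. -/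
theorem stable_of_isMinOn {n : ℕ} (hn : 0 < n) {G : SimpleGraph (Fin n)} {ε m : ℝ} (hε : 0 < ε)
    {q : ℤ} (hcyc : ∀ j, G.Adj j (finRotate n j))
    (hcommon : ∀ i j, G.Adj i j → ∃ T : Finset (Fin n), m ≤ T.card ∧
      ∀ k ∈ T, (k = i ∨ G.Adj i k) ∧ (k = j ∨ G.Adj j k))
    {z₀ : Fin n → Circle} (hz₀ : z₀ ∈ K n q) (hlow : chordEnergy G z₀ < m)
    {z : Fin n → Circle} (hz : z ∈ closure (K n q))
    (hmin : IsMinOn (energy G ε) (closure (K n q)) z) :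
    z ∈ K n q ∧ ∀ u : Fin n → ℝ, toTorus u = z →
      IsAsymptoticallyStableEquilibrium (field G ε) u := by
  -- With at least `m` common neighbours, `m · dist² ≤ 2 · chordEnergy < 2m` on each edge; a squared
  -- chord below `2` is a phase difference of positive cosine.
  have hS := chordEnergy_le_of_energy_le hn hε (hmin (subset_closure hz₀))
  have hdist : ∀ i j, G.Adj i j → dist (z j) (z i) ^ 2 < 2 := by
    intro i j hij
    obtain ⟨T, hT, hT'⟩ := hcommon i j hij
    have h1 := card_mul_dist_sq_le G z hij.ne T hT'
    rw [dist_comm] at h1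
    have h2 := mul_le_mul_of_nonneg_right hT (sq_nonneg (dist (z j) (z i)))
    by_contra! h3
    nlinarith
  have hre : ∀ i j, G.Adj i j → 0 < ((z j / z i : Circle) : ℂ).re := fun i j hij => by
    rw [re_div_eq]; linarith [hdist i j hij]
  have hdom : z ∈ indexDomain n := by
    intro j h
    have h1 := hre _ _ (hcyc j)
    rw [Circle.coe_div, h, neg_div, div_self (Circle.coe_ne_zero _)] at h1
    norm_num at h1
  have hK := mem_K_of_mem_closure hz hdom
  refine ⟨hK, ?_⟩
  rintro u rfl
  refine isAsymptoticallyStableEquilibrium_of_cos_pos hn hε (preconnected_of_adj_finRotate hcyc)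
    (fun i j hij => ?_) (field_eq_zero_of_isLocalMin G ε u ?_)
  · rw [← re_toTorus_div]; exact hre i j hij
  · exact hmin.isLocalMin (mem_of_superset ((isOpen_K n q).mem_nhds hK) subset_closure)

theorem exists_isMinOn_closure_K {n : ℕ} (G : SimpleGraph (Fin n)) (ε : ℝ) {q : ℤ}
    (h : (K n q).Nonempty) :
    ∃ z ∈ closure (K n q), IsMinOn (energy G ε) (closure (K n q)) z :=
  isClosed_closure.isCompact.exists_isMinOn h.closure (continuous_energy G ε).continuousOn

theorem isAsymptoticallyStableEquilibrium_add_const {n : ℕ} {G : SimpleGraph (Fin n)} {ε : ℝ}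
    {u : Fin n → ℝ} (h : IsAsymptoticallyStableEquilibrium (field G ε) u) (c : ℝ) :
    IsAsymptoticallyStableEquilibrium (field G ε) (fun i => u i + c) := by
  have key : ∀ v : ℝ → Fin n → ℝ, IsSolution (field G ε) v →
      IsSolution (field G ε) (fun t i => v t i + -c) := by
    intro v hv t ht
    rw [field_add_const]
    exact hasDerivWithinAt_pi.2 fun i => (hasDerivWithinAt_pi.1 (hv t ht) i).add_const _
  have hd : ∀ v : Fin n → ℝ, dist (fun i => v i + -c) u = dist v (fun i => u i + c) := by
    intro v
    rw [dist_eq_norm, dist_eq_norm]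
    congr 1
    funext i
    simp only [Pi.sub_apply]
    ring
  have hsum : ∀ v : Fin n → ℝ, ∑ i, v i = ∑ i, (u i + c) → ∑ i, (v i + -c) = ∑ i, u i := by
    intro v hv
    rw [Finset.sum_add_distrib] at hv ⊢
    rw [hv]
    simp
  obtain ⟨h0, h1, δ, hδ, h2⟩ := h
  refine ⟨by rw [field_add_const, h0], fun r hr => ?_, δ, hδ, fun v hv hs hv0 => ?_⟩
  · obtain ⟨δ, hδ, h1⟩ := h1 r hr
    refine ⟨δ, hδ, fun v hv hs hv0 t ht => ?_⟩
    rw [← hd] at hv0 ⊢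
    exact h1 _ (key v hv) (hsum _ hs) hv0 t ht
  · rw [← hd] at hv0
    have := h2 _ (key v hv) (hsum _ hs) hv0
    rw [tendsto_iff_dist_tendsto_zero] at this ⊢
    simpa only [hd] using this

theorem exists_sum_eq_zero_toTorus {n : ℕ} (hn : 0 < n) (z : Fin n → Circle) :
    ∃ u : Fin n → ℝ, ∃ c : ℝ, toTorus u = z ∧ ∑ i, (u i + c) = 0 := by
  refine ⟨fun i => Complex.arg (z i), -(∑ i, Complex.arg (z i)) / n, ?_, ?_⟩
  · funext i; exact Circle.exp_arg (z i)
  · have : (n : ℝ) ≠ 0 := by exact_mod_cast hn.ne'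
    rw [Finset.sum_add_distrib]
    simp
    field_simp
    ring

/-! ### Geodesic distance and angles on the circle -/

theorem geodesicDist_eq_angle (x y : Circle) :
    geodesicDist x y = InnerProductGeometry.angle (x : ℂ) (y : ℂ) := by
  rw [geodesicDist, InnerProductGeometry.angle, Circle.norm_coe, Circle.norm_coe, mul_one, div_one]

theorem geodesicDist_triangle (x y z : Circle) :
    geodesicDist x z ≤ geodesicDist x y + geodesicDist y z := by
  simp only [geodesicDist_eq_angle]
  exact InnerProductGeometry.angle_le_angle_add_angle _ _ _

theorem geodesicDist_nonneg (x y : Circle) : 0 ≤ geodesicDist x y := Real.arccos_nonneg _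

theorem geodesicDist_exp (a b : ℝ) :
    geodesicDist (Circle.exp a) (Circle.exp b) = Real.arccos (Real.cos (b - a)) := by
  unfold geodesicDist
  congr 1
  rw [Complex.inner, Circle.coe_exp, Circle.coe_exp, ← Complex.exp_conj, ← Complex.exp_add]
  rw [show b * Complex.I + (starRingEnd ℂ) (a * Complex.I) = ((b - a : ℝ) : ℂ) * Complex.I by
    simp; ring]
  exact Complex.exp_ofReal_mul_I_re _

theorem geodesicDist_exp_le (a b : ℝ) :
    geodesicDist (Circle.exp a) (Circle.exp b) ≤ |b - a| := by
  rw [geodesicDist_exp, ← Real.cos_abs]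
  rcases le_total |b - a| Real.pi with h | h
  · rw [Real.arccos_cos (abs_nonneg _) h]
  · exact (Real.arccos_le_pi _).trans h

theorem geodesicDist_exp_left (a : ℝ) (y : Circle) :
    geodesicDist (Circle.exp a) y = |Complex.arg ((y / Circle.exp a : Circle) : ℂ)| := by
  set θ := Complex.arg ((y / Circle.exp a : Circle) : ℂ) with hθ
  have hy : y = Circle.exp (a + θ) := by
    rw [Circle.exp_add, hθ, Circle.exp_arg, mul_div_cancel]
  conv_lhs => rw [hy]
  rw [geodesicDist_exp, add_sub_cancel_left, ← Real.cos_abs,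
    Real.arccos_cos (abs_nonneg _) (Complex.abs_arg_le_pi _)]

theorem exists_exp_eq (a : ℝ) (y : Circle) :
    ∃ b, y = Circle.exp b ∧ |b - a| = geodesicDist (Circle.exp a) y := by
  refine ⟨a + Complex.arg ((y / Circle.exp a : Circle) : ℂ), ?_, ?_⟩
  · rw [Circle.exp_add, Circle.exp_arg, mul_div_cancel]
  · rw [geodesicDist_exp_left, add_sub_cancel_left]

theorem angle_mem (x : Circle) : angle x ∈ Set.Ico 0 (2 * Real.pi) := by
  have := toIcoMod_mem_Ico Real.two_pi_pos 0 (Complex.arg (x : ℂ))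
  rwa [zero_add] at this

theorem exp_angle (x : Circle) : Circle.exp (angle x) = x := by
  unfold angle toIcoMod
  rw [Circle.exp_sub, Circle.exp_arg, zsmul_eq_mul, Circle.exp_int_mul_two_pi, div_one]

theorem angle_exp {t : ℝ} (ht : t ∈ Set.Ico 0 (2 * Real.pi)) : angle (Circle.exp t) = t := by
  have h := exp_angle (Circle.exp t)
  obtain ⟨m, hm⟩ := Circle.exp_eq_exp.1 h
  have h1 := angle_mem (Circle.exp t)
  rw [hm] at h1
  have hpi := Real.two_pi_pos
  have h2 : (m : ℝ) < 1 := by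
    by_contra! h; nlinarith [h1.2, ht.1]
  have h3 : (-1 : ℝ) < m := by
    by_contra! h; nlinarith [h1.1, ht.2]
  have : m = 0 := by
    have h2' : m < 1 := by exact_mod_cast h2
    have h3' : -1 < m := by exact_mod_cast h3
    omega
  rw [hm, this]; simp

/-- A chord subtending the angle `qθ` has squared length `2 (1 - cos (qθ)) ≤ q² θ²`. -/
theorem dist_zpow_sq_le (q : ℤ) (x y : Circle) :
    dist (x ^ q) (y ^ q) ^ 2 ≤ q ^ 2 * geodesicDist x y ^ 2 := by
  obtain ⟨b, hb, hab⟩ := exists_exp_eq (angle x) y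
  rw [exp_angle] at hab
  rw [← hab, sq_abs]
  have h := re_div_eq (y ^ q) (x ^ q)
  have h1 : y ^ q / x ^ q = Circle.exp (q * (b - angle x)) := by
    conv_lhs => rw [hb, ← exp_angle x]
    rw [← div_zpow, ← Circle.exp_sub, Circle.exp_intCast_mul]
  rw [h1, Circle.coe_exp, Complex.exp_ofReal_mul_I_re, dist_comm] at h
  have h2 := Real.one_sub_sq_div_two_le_cos (x := q * (b - angle x))
  nlinarith

/-! ### Regular samples: gaps, the twisted state, common neighbours and degrees -/

/-- The number of coordinates in a set. -/
noncomputable def hits {n : ℕ} (A : Set Circle) (x : Fin n → Circle) : ℝ :=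
  ∑ k, A.indicator (fun _ => (1 : ℝ)) (x k)

open Classical in
theorem card_filter_eq_hits {n : ℕ} (A : Set Circle) (x : Fin n → Circle) :
    ((Finset.univ.filter (fun k => x k ∈ A)).card : ℝ) = hits A x := by
  rw [hits, Finset.card_filter]
  push_cast
  exact Finset.sum_congr rfl fun k _ => by rw [Set.indicator_apply]

theorem hits_nodes {n : ℕ} (A : Set Circle) (x : Fin n → Circle) :
    hits A (nodes x) = hits A x := by
  unfold hits nodes
  exact Equiv.sum_comp (Tuple.sort fun i => angle (x i)) fun k => A.indicator (fun _ => (1 : ℝ)) (x k)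

theorem monotone_angle_nodes {n : ℕ} (x : Fin n → Circle) :
    Monotone fun i => angle (nodes x i) :=
  Tuple.monotone_sort fun i => angle (x i)

/-- The `l`-th half-open arc of length `w`. -/
def cell (w : ℝ) (l : ℕ) : Set Circle := {x | angle x ∈ Set.Ico (l * w) ((l + 1) * w)}

/-- The open geodesic ball of radius `r` about the point of angle `l * w`. -/
def arcBall (w r : ℝ) (l : ℕ) : Set Circle := {x | geodesicDist (Circle.exp (l * w)) x < r}

theorem exists_mem_cell {N : ℕ} {w : ℝ} (hw : 0 < w) (hN : N * w = 2 * Real.pi) (x : Circle) :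
    ∃ l < N, x ∈ cell w l := by
  have h := angle_mem x
  refine ⟨⌊angle x / w⌋₊, ?_, ?_, ?_⟩
  · rw [Nat.floor_lt (div_nonneg h.1 hw.le), div_lt_iff₀ hw, hN]
    exact h.2
  · rw [← le_div_iff₀ hw]
    exact Nat.floor_le (div_nonneg h.1 hw.le)
  · rw [← div_lt_iff₀ hw]
    exact Nat.lt_floor_add_one _

theorem exists_mem_of_hits_pos {n : ℕ} {A : Set Circle} {x : Fin n → Circle} (h : 0 < hits A x) :
    ∃ k, x k ∈ A := by
  classical
  rw [← card_filter_eq_hits, Nat.cast_pos, Finset.card_pos] at h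
  obtain ⟨k, hk⟩ := h
  exact ⟨k, by simpa using hk⟩

/-- When every arc contains a node, cyclically consecutive nodes are close, and the signed gaps
between them add up to a full turn. -/
theorem exists_gaps {n : ℕ} (hn : 0 < n) {y : Fin n → Circle} (hy : Monotone fun i => angle (y i))
    {N : ℕ} (hN0 : 0 < N) {w : ℝ} (hw : 0 < w) (hN : N * w = 2 * Real.pi)
    (hcell : ∀ l < N, ∃ k, y k ∈ cell w l) :
    ∃ g : Fin n → ℝ, (∀ j, 0 ≤ g j ∧ g j < 2 * w) ∧
      (∀ j, y (finRotate n j) = y j * Circle.exp (g j)) ∧ ∑ j, g j = 2 * Real.pi := by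
  obtain ⟨n, rfl⟩ : ∃ m, n = m + 1 := ⟨n - 1, by omega⟩
  have hpi := Real.two_pi_pos
  refine ⟨fun j => angle (y (finRotate (n + 1) j)) - angle (y j) +
    -- The last gap crosses the angle `0`; the other differences telescope, so this `2π` is the
    -- whole sum.
    if j = Fin.last n then 2 * Real.pi else 0, fun j => ?_, fun j => ?_, ?_⟩
  · have hj := angle_mem (y j)
    have hj' := angle_mem (y (finRotate (n + 1) j))
    by_cases hl : j = Fin.last n
    · simp only [hl, if_true]
      rw [hl] at hj hj'
      refine ⟨by linarith [hj.2, hj'.1], ?_⟩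
      rw [finRotate_last]
      obtain ⟨k, hk⟩ := hcell 0 hN0
      obtain ⟨k', hk'⟩ := hcell (N - 1) (by omega)
      have h1 := hy (Fin.zero_le k)
      have h2 := hy (Fin.le_last k')
      have h3 := hk.2
      have h4 := hk'.1
      rw [Nat.cast_sub hN0] at h4
      simp only [Nat.cast_zero, Nat.cast_one] at h1 h2 h3 h4
      linarith
    · simp only [hl, if_false, add_zero]
      have hlt := (lt_finRotate_iff_ne_last j).2 hl
      refine ⟨sub_nonneg.2 (hy hlt.le), ?_⟩
      obtain ⟨l, hlN, hlc⟩ := exists_mem_cell hw hN (y j)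
      have h1 := hlc.1
      rcases Nat.lt_or_ge (l + 1) N with h | h
      · obtain ⟨k, hk⟩ := hcell (l + 1) h
        have h2 := hk.1
        have h3 := hk.2
        have hjk : j < k := by
          by_contra! hc
          have h4 := hy hc
          have h5 := hlc.2
          push_cast at h2
          simp only at h4
          linarith
        have h4 : finRotate (n + 1) j ≤ k := by
          rw [Fin.le_def, coe_finRotate_of_ne_last hl]
          exact hjk
        have h5 := hy h4
        push_cast at h3
        simp only at h5
        linarith
      · have : l + 1 = N := by omega
        rw [← this] at hN
        push_cast at hN
        linarith [hj'.2]
  · simp only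
    have h2 : Circle.exp (if j = Fin.last n then 2 * Real.pi else 0) = 1 := by
      split_ifs <;> simp
    rw [Circle.exp_add, Circle.exp_sub, exp_angle, exp_angle, h2, mul_one, mul_div_cancel]
  · rw [Finset.sum_add_distrib, Finset.sum_sub_distrib,
      Equiv.sum_comp (finRotate (n + 1)) fun j => angle (y j)]
    simp

/-- Since `|q g_j| < π`, the principal argument of each quotient is exactly `q g_j`, and the total
is `q` full turns. -/
theorem zpow_mem_K {n : ℕ} {y : Fin n → Circle} {g : Fin n → ℝ} (q : ℤ)
    (hg : ∀ j, |q * g j| < Real.pi) (hy : ∀ j, y (finRotate n j) = y j * Circle.exp (g j))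
    (hsum : ∑ j, g j = 2 * Real.pi) : (fun j => y j ^ q) ∈ K n q := by
  have hdiv : ∀ j, y (finRotate n j) ^ q / y j ^ q = Circle.exp (q * g j) := fun j => by
    rw [hy j, ← div_zpow, mul_div_cancel_left, Circle.exp_intCast_mul]
  have harg : ∀ j, Complex.arg ((y (finRotate n j) ^ q / y j ^ q : Circle) : ℂ) = q * g j :=
    fun j => by
      have := abs_lt.1 (hg j)
      rw [hdiv, Circle.arg_exp this.1 this.2.le]
  refine ⟨fun j h => ?_, ?_⟩
  · have h1 := harg j
    simp only at h
    rw [Circle.coe_div, h, neg_div, div_self (Circle.coe_ne_zero _), Complex.arg_neg_one] at h1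
    have := hg j
    rw [← h1, abs_of_pos Real.pi_pos] at this
    exact lt_irrefl _ this
  · rw [index_eq_intCast_iff]
    unfold argSum
    simp only [harg]
    rw [← Finset.mul_sum, hsum]

theorem exists_midpoint {x y : Circle} {r : ℝ} (h : geodesicDist x y < r) :
    ∃ p, geodesicDist x p < r / 2 ∧ geodesicDist y p < r / 2 := by
  obtain ⟨b, hb, hab⟩ := exists_exp_eq (angle x) y
  rw [exp_angle] at hab
  refine ⟨Circle.exp ((angle x + b) / 2), ?_, ?_⟩
  · have h1 := geodesicDist_exp_le (angle x) ((angle x + b) / 2)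
    rw [exp_angle, show (angle x + b) / 2 - angle x = (b - angle x) / 2 by ring, abs_div, hab,
      abs_two] at h1
    linarith
  · have h1 := geodesicDist_exp_le b ((angle x + b) / 2)
    rw [← hb, show (angle x + b) / 2 - b = -((b - angle x) / 2) by ring, abs_neg, abs_div, hab,
      abs_two] at h1
    linarith

theorem geodesicDist_lt_of_mem_cell {w : ℝ} {l : ℕ} {x y : Circle} (hx : x ∈ cell w l)
    (hy : y ∈ cell w l) : geodesicDist x y < w := by
  have h := geodesicDist_exp_le (angle x) (angle y)
  rw [exp_angle, exp_angle] at h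
  refine h.trans_lt (abs_lt.2 ⟨?_, ?_⟩) <;> linarith [hx.1, hx.2, hy.1, hy.2]

/-- Deterministic consequences of the regularity of the sample. -/
theorem rgg_properties {n : ℕ} (hn : 0 < n) (x : Fin n → Circle) {ε w m M : ℝ} {N : ℕ}
    (hN0 : 0 < N) (hw : 0 < w) (hN : N * w = 2 * Real.pi) (hwε : 2 * w < ε) (hwπ : w < Real.pi)
    (hm : 0 < m) (q : ℤ) (hq : |(q : ℝ)| * ε < Real.pi)
    (hlow : ∀ l < N, m ≤ hits (cell w l) x) (hup : ∀ l < N, hits (arcBall w (2 * ε) l) x ≤ M) :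
    (∀ j, (rgg x ε).Adj j (finRotate n j)) ∧
    (∀ i j, (rgg x ε).Adj i j → ∃ T : Finset (Fin n), m ≤ T.card ∧
      ∀ k ∈ T, (k = i ∨ (rgg x ε).Adj i k) ∧ (k = j ∨ (rgg x ε).Adj j k)) ∧
    (fun j => nodes x j ^ q) ∈ K n q ∧
    chordEnergy (rgg x ε) (fun j => nodes x j ^ q) ≤ n * M * (q ^ 2 * ε ^ 2) := by
  classical
  set y := nodes x with hy
  have hcell : ∀ l < N, ∃ k, y k ∈ cell w l := fun l hl =>
    exists_mem_of_hits_pos (by rw [hy, hits_nodes]; exact hm.trans_le (hlow l hl))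
  obtain ⟨g, hg, hrot, hsum⟩ := exists_gaps hn (monotone_angle_nodes x) hN0 hw hN hcell
  refine ⟨fun j => ⟨fun h => ?_, ?_⟩, fun i j hij => ?_, ?_, ?_⟩
  · have h1 : g j = 0 := by
      have h2 := hrot j
      rw [← h, left_eq_mul, Circle.exp_eq_one] at h2
      obtain ⟨k, hk⟩ := h2
      have h3 := hg j
      have h4 : (k : ℝ) < 1 := by
        by_contra! hc; nlinarith [Real.pi_pos]
      have h5 : (-1 : ℝ) < k := by
        by_contra! hc; nlinarith [Real.pi_pos]
      have h6 : k = 0 := by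
        have h4' : k < 1 := by exact_mod_cast h4
        have h5' : -1 < k := by exact_mod_cast h5
        omega
      rw [hk, h6]; simp
    -- Only for `n = 1` does the cyclic shift have a fixed point; the single gap would then be both
    -- `0` and `2π`.
    have hn1 : n = 1 := by
      by_contra hc
      obtain ⟨n, rfl⟩ : ∃ m, n = m + 1 := ⟨n - 1, by omega⟩
      by_cases hl : j = Fin.last n
      · rw [hl, finRotate_last] at h
        have := congrArg Fin.val h
        simp at this
        omega
      · exact absurd h ((lt_finRotate_iff_ne_last j).2 hl).ne
    subst hn1
    rw [Fin.sum_univ_one, ← Subsingleton.elim j 0, h1] at hsum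
    linarith [Real.pi_pos]
  · have h1 := geodesicDist_exp_le (angle (y j)) (angle (y j) + g j)
    rw [Circle.exp_add, exp_angle, ← hrot, add_sub_cancel_left, abs_of_nonneg (hg j).1] at h1
    linarith [(hg j).2]
  · obtain ⟨p, hp1, hp2⟩ := exists_midpoint hij.2
    obtain ⟨l, hl, hpl⟩ := exists_mem_cell hw hN p
    refine ⟨Finset.univ.filter (fun k => y k ∈ cell w l), ?_, fun k hk => ?_⟩
    · rw [card_filter_eq_hits, hy, hits_nodes]; exact hlow l hl
    · have hk' : y k ∈ cell w l := by simpa using hk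
      have h1 := geodesicDist_lt_of_mem_cell hpl hk'
      refine ⟨?_, ?_⟩
      · rw [or_iff_not_imp_left]
        refine fun hne => ⟨Ne.symm hne, ?_⟩
        have := geodesicDist_triangle (y i) p (y k)
        linarith
      · rw [or_iff_not_imp_left]
        refine fun hne => ⟨Ne.symm hne, ?_⟩
        have := geodesicDist_triangle (y j) p (y k)
        linarith
  · refine zpow_mem_K q (fun j => ?_) hrot hsum
    rw [abs_mul, abs_of_nonneg (hg j).1]
    refine lt_of_le_of_lt (mul_le_mul_of_nonneg_left ?_ (abs_nonneg _)) hq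
    linarith [(hg j).2]
  · have hdeg : ∀ i, ((Finset.univ.filter (fun j => (rgg x ε).Adj i j)).card : ℝ) ≤ M := by
      intro i
      obtain ⟨l, hl, hil⟩ := exists_mem_cell hw hN (y i)
      refine le_trans ?_ (hup l hl)
      rw [← hits_nodes, ← card_filter_eq_hits]
      refine Nat.cast_le.2 (Finset.card_le_card fun k hk => ?_)
      have hk' : geodesicDist (y i) (y k) < ε := by
        have : (rgg x ε).Adj i k := by simpa using hk
        exact this.2
      simp only [Finset.mem_filter, Finset.mem_univ, true_and]
      have h1 := geodesicDist_triangle (Circle.exp (l * w)) (y i) (y k)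
      have h2 := geodesicDist_exp_le (l * w) (angle (y i))
      rw [exp_angle, abs_of_nonneg (sub_nonneg.2 hil.1)] at h2
      have h3 := hil.2
      show geodesicDist (Circle.exp (l * w)) (y k) < 2 * ε
      linarith
    unfold chordEnergy
    calc _ ≤ ∑ i : Fin n, M * (q ^ 2 * ε ^ 2) := by
          refine Finset.sum_le_sum fun i _ => ?_
          refine le_trans (Finset.sum_le_card_nsmul _ _ ((q : ℝ) ^ 2 * ε ^ 2) fun k hk => ?_) ?_
          · have hk' : (rgg x ε).Adj i k := by simpa using hk
            rw [dist_comm]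
            refine (dist_zpow_sq_le q (y i) (y k)).trans ?_
            have := hk'.2.le
            have h0 := geodesicDist_nonneg (y i) (y k)
            gcongr
          · rw [nsmul_eq_mul]
            exact mul_le_mul_of_nonneg_right (hdeg i) (by positivity)
      _ = n * M * (q ^ 2 * ε ^ 2) := by simp; ring

/-! ### Measurability and uniform measure of arcs -/

theorem angle_eq (x : Circle) : angle x =
    if 0 ≤ Complex.arg (x : ℂ) then Complex.arg (x : ℂ) else Complex.arg (x : ℂ) + 2 * Real.pi := by
  have h1 := Complex.arg_le_pi (x : ℂ)
  have h2 := Complex.neg_pi_lt_arg (x : ℂ)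
  have hpi := Real.pi_pos
  split_ifs with h
  · conv_lhs => rw [← Circle.exp_arg x]
    exact angle_exp ⟨h, by linarith⟩
  · push Not at h
    conv_lhs => rw [← Circle.exp_arg x, ← Circle.exp_add_two_pi]
    exact angle_exp ⟨by linarith, by linarith⟩

theorem measurable_coe_circle : Measurable (fun x : Circle => (x : ℂ)) := by
  have h : Continuous (fun x : Circle => (x : ℂ)) := by fun_prop
  exact h.measurable

theorem measurable_angle : Measurable angle := by
  have h : Measurable fun x : Circle => Complex.arg (x : ℂ) :=
    Complex.measurable_arg.comp measurable_coe_circle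
  rw [show angle = _ from funext angle_eq]
  exact Measurable.ite (measurableSet_le measurable_const h) h (h.add_const _)

theorem measurableSet_cell (w : ℝ) (l : ℕ) : MeasurableSet (cell w l) :=
  measurable_angle measurableSet_Ico

theorem measurableSet_arcBall (w r : ℝ) (l : ℕ) : MeasurableSet (arcBall w r l) := by
  have h : Measurable fun x : Circle => geodesicDist (Circle.exp (l * w)) x := by
    unfold geodesicDist
    exact Real.measurable_arccos.comp (measurable_const.inner measurable_coe_circle)
  exact measurableSet_lt h measurable_const

theorem uniformCircle_real {A : Set Circle} (hA : MeasurableSet A) :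
    uniformCircle.real A =
      volume.real (Set.Ico 0 (2 * Real.pi) ∩ Circle.exp ⁻¹' A) / (2 * Real.pi) := by
  have hexp : Measurable (Circle.exp : ℝ → Circle) := Circle.exp.continuous.measurable
  unfold uniformCircle
  rw [Measure.real, Measure.map_apply hexp hA, cond_apply measurableSet_Ico, ENNReal.toReal_mul,
    ENNReal.toReal_inv, ← Measure.real, ← Measure.real,
    Real.volume_real_Ico_of_le Real.two_pi_pos.le, sub_zero, inv_mul_eq_div]

theorem uniformCircle_real_cell {N : ℕ} {w : ℝ} (hw : 0 < w) (hN : N * w = 2 * Real.pi) {l : ℕ}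
    (hl : l < N) : uniformCircle.real (cell w l) = 1 / N := by
  have hN0 : (0 : ℝ) < N := by exact_mod_cast (Nat.zero_le l).trans_lt hl
  have h1 : Set.Ico 0 (2 * Real.pi) ∩ Circle.exp ⁻¹' (cell w l) =
      Set.Ico (l * w) ((l + 1) * w) := by
    ext t
    constructor
    · rintro ⟨h1, h2⟩
      have h3 : angle (Circle.exp t) ∈ Set.Ico (l * w) ((l + 1) * w) := h2
      rwa [angle_exp h1] at h3
    · intro h
      have h2 : ((l : ℝ) + 1) * w ≤ N * w := by
        have : ((l : ℝ) + 1) ≤ N := by exact_mod_cast hl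
        gcongr
      have h3 : t ∈ Set.Ico 0 (2 * Real.pi) :=
        ⟨le_trans (by positivity) h.1, lt_of_lt_of_le h.2 (by linarith)⟩
      refine ⟨h3, ?_⟩
      show angle (Circle.exp t) ∈ Set.Ico (l * w) ((l + 1) * w)
      rwa [angle_exp h3]
  rw [uniformCircle_real (measurableSet_cell w l), h1, Real.volume_real_Ico_of_le (by nlinarith),
    ← hN]
  field_simp
  ring

theorem uniformCircle_real_arcBall_le {N : ℕ} {w r : ℝ} (hw : 0 < w) (hN : N * w = 2 * Real.pi)
    (hr : 0 < r) (hrπ : r ≤ 2 * Real.pi) {l : ℕ} (hl : l < N) :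
    uniformCircle.real (arcBall w r l) ≤ r := by
  have hpi := Real.pi_pos
  set a : ℝ := l * w with ha
  have ha0 : 0 ≤ a := by positivity
  have ha1 : a < 2 * Real.pi := by
    rw [← hN, ha]
    have : (l : ℝ) < N := by exact_mod_cast hl
    gcongr
  -- The ball may wrap around the angle `0`, so three translates are allowed; the crude total `6r`
  -- suffices because `6 ≤ 2π`.
  have hsub : Set.Ico 0 (2 * Real.pi) ∩ Circle.exp ⁻¹' (arcBall w r l) ⊆
      ⋃ m ∈ Finset.Icc (-1 : ℤ) 1, Set.Ioo (a + m * (2 * Real.pi) - r) (a + m * (2 * Real.pi) + r) := by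
    rintro t ⟨ht, h⟩
    have h1 : geodesicDist (Circle.exp a) (Circle.exp t) < r := h
    obtain ⟨b, hb, hab⟩ := exists_exp_eq a (Circle.exp t)
    rw [← hab] at h1
    obtain ⟨m, hm⟩ := Circle.exp_eq_exp.1 hb
    have h2 := abs_lt.1 h1
    have h3 : (m : ℝ) < 2 := by
      by_contra! hc; nlinarith [ht.2]
    have h4 : (-2 : ℝ) < m := by
      by_contra! hc; nlinarith [ht.1]
    have h3' : m < 2 := by exact_mod_cast h3
    have h4' : -2 < m := by exact_mod_cast h4
    refine Set.mem_iUnion₂.2 ⟨m, Finset.mem_Icc.2 ⟨by omega, by omega⟩, ?_, ?_⟩ <;> linarith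
  rw [uniformCircle_real (measurableSet_arcBall w r l), div_le_iff₀ (by positivity)]
  have hfin : volume (⋃ m ∈ Finset.Icc (-1 : ℤ) 1,
      Set.Ioo (a + m * (2 * Real.pi) - r) (a + m * (2 * Real.pi) + r)) ≠ ⊤ := by
    refine ((measure_biUnion_finset_le _ _).trans_lt (ENNReal.sum_lt_top.2 fun m _ => ?_)).ne
    simp
  refine (measureReal_mono hsub hfin).trans ((measureReal_biUnion_finset_le _ _).trans ?_)
  calc _ = ∑ m ∈ Finset.Icc (-1 : ℤ) 1, 2 * r := by
        refine Finset.sum_congr rfl fun m _ => ?_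
        rw [Real.volume_real_Ioo_of_le (by linarith)]; ring
    _ = 6 * r := by simp; ring
    _ ≤ r * (2 * Real.pi) := by nlinarith [Real.pi_gt_three]

/-! ### Chernoff bounds for the number of sample points in an arc -/

theorem mgf_indicator_comp {Ω E : Type*} [MeasurableSpace Ω] [MeasurableSpace E] {P : Measure Ω}
    {μ : Measure E} [IsProbabilityMeasure μ] {A : Set E} {X : Ω → E} (hX : HasLaw X μ P)
    (hA : MeasurableSet A) (t : ℝ) :
    mgf (fun ω => A.indicator (fun _ => (1 : ℝ)) (X ω)) P t =
      1 + μ.real A * (Real.exp t - 1) := by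
  have h : ∀ x, Real.exp (t * A.indicator (fun _ => (1 : ℝ)) x) =
      1 + A.indicator (fun _ => Real.exp t - 1) x := fun x => by
    by_cases hx : x ∈ A <;> simp [hx]
  have hm : Measurable fun x => 1 + A.indicator (fun _ => Real.exp t - 1) x :=
    (measurable_const.indicator hA).const_add 1
  unfold mgf
  simp only [h]
  refine (hX.integral_comp hm.aestronglyMeasurable).trans ?_
  rw [integral_add (integrable_const _) ((integrable_const _).indicator hA),
    integral_indicator_const _ hA]
  simp

section

variable {Ω : Type*} [MeasurableSpace Ω] {P : Measure Ω}
  {μ : Measure Circle} [IsProbabilityMeasure μ] {A : Set Circle} {n : ℕ} {X : Fin n → Ω → Circle}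

/-- The binomial moment generating function is dominated by the Poisson one of the same mean,
through `1 + x ≤ exp x`. -/
theorem mgf_hits_le (hX : ∀ i, HasLaw (X i) μ P) (hind : iIndepFun X P) (hA : MeasurableSet A)
    (t : ℝ) : mgf (fun ω => hits A fun i => X i ω) P t ≤
      Real.exp (n * (μ.real A * (Real.exp t - 1))) := by
  have hmi : Measurable (A.indicator fun _ => (1 : ℝ)) := measurable_const.indicator hA
  have h1 := (hind.comp (fun _ => A.indicator fun _ => (1 : ℝ)) fun _ => hmi).mgf_sum₀ (t := t)
    (fun i => hmi.comp_aemeasurable (hX i).aemeasurable) Finset.univ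
  have h2 : (∑ i, (A.indicator fun _ => (1 : ℝ)) ∘ X i) = fun ω => hits A fun i => X i ω := by
    funext ω; simp [hits]
  rw [h2] at h1
  rw [h1]
  calc _ = ∏ _i : Fin n, (1 + μ.real A * (Real.exp t - 1)) :=
        Finset.prod_congr rfl fun i _ => mgf_indicator_comp (hX i) hA t
    _ = (1 + μ.real A * (Real.exp t - 1)) ^ n := by simp
    _ ≤ Real.exp (μ.real A * (Real.exp t - 1)) ^ n := by
        refine pow_le_pow_left₀ ?_ ?_ n
        · have h3 : μ.real A ≤ 1 := measureReal_le_one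
          nlinarith [Real.exp_pos t, measureReal_nonneg (μ := μ) (s := A)]
        · linarith [Real.add_one_le_exp (μ.real A * (Real.exp t - 1))]
    _ = _ := by rw [← Real.exp_nat_mul]

theorem integrable_exp_mul_hits [IsProbabilityMeasure P]
    (hX : ∀ i, AEMeasurable (X i) P) (hA : MeasurableSet A) (t : ℝ) :
    Integrable (fun ω => Real.exp (t * hits A fun i => X i ω)) P := by
  have hmi : Measurable (A.indicator fun _ => (1 : ℝ)) := measurable_const.indicator hA
  have hm : AEMeasurable (fun ω => hits A fun i => X i ω) P := by
    unfold hits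
    exact Finset.aemeasurable_fun_sum _ fun i _ => hmi.comp_aemeasurable (hX i)
  refine Integrable.of_bound (hm.const_mul t).exp.aestronglyMeasurable (Real.exp (|t| * n))
    (Eventually.of_forall fun ω => ?_)
  rw [Real.norm_of_nonneg (Real.exp_pos _).le, Real.exp_le_exp]
  have h0 : 0 ≤ hits A fun i => X i ω :=
    Finset.sum_nonneg fun i _ => Set.indicator_nonneg (fun _ _ => zero_le_one) _
  have h1 : (hits A fun i => X i ω) ≤ n := by
    unfold hits
    calc _ ≤ ∑ _i : Fin n, (1 : ℝ) := Finset.sum_le_sum fun i _ => by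
          by_cases h : X i ω ∈ A <;> simp [h]
      _ = n := by simp
  calc t * hits A (fun i => X i ω) ≤ |t| * hits A (fun i => X i ω) := by
        gcongr; exact le_abs_self t
    _ ≤ |t| * n := by gcongr

/-- Chernoff bound for the lower tail. -/
theorem measure_hits_le [IsProbabilityMeasure P]
    (hX : ∀ i, HasLaw (X i) μ P) (hind : iIndepFun X P)
    (hA : MeasurableSet A) (a : ℝ) :
    P.real {ω | (hits A fun i => X i ω) ≤ a} ≤ Real.exp (a - n * μ.real A / 2) := by
  refine (measure_le_le_exp_mul_mgf a (t := -1) (by norm_num)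
    (integrable_exp_mul_hits (fun i => (hX i).aemeasurable) hA _)).trans ?_
  refine (mul_le_mul_of_nonneg_left (mgf_hits_le hX hind hA _) (Real.exp_pos _).le).trans ?_
  rw [← Real.exp_add, Real.exp_le_exp]
  have h1 : Real.exp (-1) ≤ 1 / 2 := by
    rw [Real.exp_neg, ← one_div]
    exact one_div_le_one_div_of_le two_pos (by linarith [Real.add_one_le_exp (1 : ℝ)])
  have h2 : 0 ≤ n * μ.real A := by positivity
  nlinarith

/-- Chernoff bound for the upper tail. -/
theorem measure_le_hits [IsProbabilityMeasure P]
    (hX : ∀ i, HasLaw (X i) μ P) (hind : iIndepFun X P)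
    (hA : MeasurableSet A) (a : ℝ) :
    P.real {ω | a ≤ hits A fun i => X i ω} ≤ Real.exp (2 * (n * μ.real A) - a) := by
  refine (measure_ge_le_exp_mul_mgf a (t := 1) (by norm_num)
    (integrable_exp_mul_hits (fun i => (hX i).aemeasurable) hA _)).trans ?_
  refine (mul_le_mul_of_nonneg_left (mgf_hits_le hX hind hA _) (Real.exp_pos _).le).trans ?_
  rw [← Real.exp_add, Real.exp_le_exp]
  have h1 : Real.exp 1 ≤ 3 := by linarith [Real.exp_one_lt_d9]
  have h2 : 0 ≤ n * μ.real A := by positivity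
  nlinarith

end

instance : IsProbabilityMeasure uniformCircle := by
  have : IsProbabilityMeasure (cond (volume : Measure ℝ) (Set.Ico (0 : ℝ) (2 * Real.pi))) :=
    cond_isProbabilityMeasure_of_finite (by simp [Real.pi_pos])
      (by rw [Real.volume_Ico]; exact ENNReal.ofReal_ne_top)
  exact Measure.isProbabilityMeasure_map Circle.exp.continuous.measurable.aemeasurable

/-- Every cell of a fine partition contains many sample points and every ball few, up to an event of
small probability. -/
theorem measure_irregular_le {Ω : Type*} [MeasurableSpace Ω] {P : Measure Ω}
    [IsProbabilityMeasure P] {n : ℕ} {X : Fin n → Ω → Circle}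
    (hX : ∀ i, HasLaw (X i) uniformCircle P) (hind : iIndepFun X P) {N : ℕ} {w ε : ℝ} (hw : 0 < w)
    (hN : N * w = 2 * Real.pi) (hε : 0 < ε) (hεπ : ε ≤ Real.pi) :
    P.real (⋃ l ∈ Finset.range N, ({ω | (hits (cell w l) fun i => X i ω) ≤ n / (4 * N)} ∪
      {ω | 6 * n * ε ≤ hits (arcBall w (2 * ε) l) fun i => X i ω})) ≤
      N * (Real.exp (-(n / (4 * N))) + Real.exp (-(2 * n * ε))) := by
  refine (measureReal_biUnion_finset_le _ _).trans ((Finset.sum_le_card_nsmul _ _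
    (Real.exp (-(n / (4 * N))) + Real.exp (-(2 * n * ε))) fun l hl => ?_).trans_eq
    (by rw [Finset.card_range, nsmul_eq_mul]))
  have hl' := Finset.mem_range.1 hl
  refine (measureReal_union_le _ _).trans (add_le_add ?_ ?_)
  · refine (measure_hits_le hX hind (measurableSet_cell w l) _).trans (Real.exp_le_exp.2 ?_)
    rw [uniformCircle_real_cell hw hN hl']
    have : (N : ℝ) ≠ 0 := by
      have : 0 < N := by omega
      positivity
    apply le_of_eq
    field_simp
    ring
  · refine (measure_le_hits hX hind (measurableSet_arcBall w (2 * ε) l) _).trans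
      (Real.exp_le_exp.2 ?_)
    have h1 := uniformCircle_real_arcBall_le hw hN (r := 2 * ε) (by positivity) (by linarith) hl'
    have h2 : n * uniformCircle.real (arcBall w (2 * ε) l) ≤ n * (2 * ε) := by gcongr
    linarith

/-! ### The scale of the partition and passage to the limit -/

/-- The events are not assumed measurable; subadditivity, `1 ≤ P A + P Aᶜ`, still yields the first
clause from the second. -/
theorem withHighProbability_of_compl_subset {Ω : ℕ → Type*} [∀ n, MeasurableSpace (Ω n)]
    {P : ∀ n, Measure (Ω n)} [∀ n, IsProbabilityMeasure (P n)] {A B : ∀ n, Set (Ω n)} {b : ℕ → ℝ}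
    (hAB : ∀ᶠ n in atTop, (A n)ᶜ ⊆ B n) (hB : ∀ᶠ n in atTop, (P n).real (B n) ≤ b n)
    (hb : Tendsto b atTop (𝓝 0)) : WithHighProbability P A := by
  have h0 : Tendsto (fun n => P n (A n)ᶜ) atTop (𝓝 0) := by
    have h1 : Tendsto (fun n => ENNReal.ofReal (b n)) atTop (𝓝 0) := by
      simpa using ENNReal.tendsto_ofReal hb
    refine tendsto_of_tendsto_of_tendsto_of_le_of_le' tendsto_const_nhds h1
      (Eventually.of_forall fun _ => zero_le) ?_
    filter_upwards [hAB, hB] with n h2 h3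
    exact (measure_mono h2).trans (by
      rw [← ofReal_measureReal]; exact ENNReal.ofReal_le_ofReal h3)
  refine ⟨?_, h0⟩
  have h1 : Tendsto (fun n => 1 - P n (A n)ᶜ) atTop (𝓝 1) := by
    simpa using ENNReal.Tendsto.sub tendsto_const_nhds h0 (Or.inl ENNReal.one_ne_top)
  refine tendsto_of_tendsto_of_tendsto_of_le_of_le h1 tendsto_const_nhds (fun n => ?_)
    fun n => prob_le_one
  rw [tsub_le_iff_right, ← measure_univ (μ := P n), ← Set.union_compl_self (A n)]
  exact measure_union_le _ _

/-- The number of cells at scale `ε`. -/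
noncomputable def numCells (ε : ℝ) : ℕ := ⌊4 * Real.pi / ε⌋₊ + 1

/-- The length of a cell at scale `ε`. -/
noncomputable def cellWidth (ε : ℝ) : ℝ := 2 * Real.pi / numCells ε

theorem numCells_pos (ε : ℝ) : 0 < numCells ε := Nat.succ_pos _

theorem numCells_mul_cellWidth (ε : ℝ) : numCells ε * cellWidth ε = 2 * Real.pi := by
  have : (numCells ε : ℝ) ≠ 0 := by exact_mod_cast (numCells_pos ε).ne'
  unfold cellWidth
  field_simp

theorem cellWidth_pos (ε : ℝ) : 0 < cellWidth ε := by
  have := numCells_pos ε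
  unfold cellWidth
  positivity

theorem two_mul_cellWidth_lt {ε : ℝ} (hε : 0 < ε) : 2 * cellWidth ε < ε := by
  have h1 : 4 * Real.pi / ε < numCells ε := by
    unfold numCells
    push_cast
    exact Nat.lt_floor_add_one _
  have h2 : (0 : ℝ) < numCells ε := by exact_mod_cast numCells_pos ε
  unfold cellWidth
  rw [div_lt_iff₀ hε] at h1
  rw [← mul_div_assoc, div_lt_iff₀ h2]
  linarith

theorem numCells_mul_le {ε : ℝ} (hε : 0 < ε) (hε1 : ε ≤ 1) : numCells ε * ε ≤ 14 := by
  have h1 : (⌊4 * Real.pi / ε⌋₊ : ℝ) ≤ 4 * Real.pi / ε := Nat.floor_le (by positivity)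
  rw [le_div_iff₀ hε] at h1
  unfold numCells
  push_cast
  -- The constant `14` exceeds `4π + 1`.
  linarith [Real.pi_lt_d2]

/-- The event that some cell contains few sample points or some ball many. -/
def irregular {Ω : Type*} {n : ℕ} (X : Fin n → Ω → Circle) (ε : ℝ) : Set Ω :=
  ⋃ l ∈ Finset.range (numCells ε),
    ({ω | (hits (cell (cellWidth ε) l) fun i => X i ω) ≤ n / (4 * numCells ε)} ∪
      {ω | 6 * n * ε ≤ hits (arcBall (cellWidth ε) (2 * ε) l) fun i => X i ω})

theorem measure_irregular_le_div {Ω : Type*} [MeasurableSpace Ω] {P : Measure Ω}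
    [IsProbabilityMeasure P] {n : ℕ} {X : Fin n → Ω → Circle}
    (hX : ∀ i, HasLaw (X i) uniformCircle P) (hind : iIndepFun X P) {ε : ℝ} (hε : 0 < ε)
    (hε1 : ε ≤ 1) (hn : 3 ≤ n) (hlog : 112 * Real.log n ≤ n * ε) :
    P.real (irregular X ε) ≤ 28 / n := by
  have hn0 : (0 : ℝ) < n := by positivity
  have hN0 : (0 : ℝ) < numCells ε := by exact_mod_cast numCells_pos ε
  have hN := numCells_mul_le hε hε1
  refine (measure_irregular_le hX hind (cellWidth_pos ε) (numCells_mul_cellWidth ε) hε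
    (by linarith [Real.pi_gt_three])).trans ?_
  have hlog1 : 1 ≤ Real.log n := by
    rw [Real.le_log_iff_exp_le hn0]
    have : (3 : ℝ) ≤ n := by exact_mod_cast hn
    linarith [Real.exp_one_lt_d9]
  have hexp : ∀ a : ℝ, 2 * Real.log n ≤ a → Real.exp (-a) ≤ 1 / (n : ℝ) ^ 2 := fun a ha => by
    rw [Real.exp_neg, ← one_div]
    refine one_div_le_one_div_of_le (by positivity) ?_
    rw [← Real.log_le_iff_le_exp (by positivity), Real.log_pow]
    exact_mod_cast ha
  -- With `N ε ≤ 14`, the exponent `n / (4N)` is at least `nε / 56`, hence at least `2 log n` when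
  -- `nε ≥ 112 log n`.
  have h1 := hexp (n / (4 * numCells ε)) (by
    rw [le_div_iff₀ (by positivity)]
    have h2 : 112 * Real.log n * numCells ε ≤ n * ε * numCells ε := by gcongr
    nlinarith)
  have h2 := hexp (2 * n * ε) (by nlinarith)
  have h3 : (numCells ε : ℝ) ≤ 14 * n := by
    have : 1 ≤ n * ε := by linarith
    nlinarith
  calc _ ≤ 14 * n * (1 / (n : ℝ) ^ 2 + 1 / (n : ℝ) ^ 2) := by gcongr
    _ = 28 / n := by field_simp; norm_num

/-- On a regular sample the minimisers of the energy over the closure of `K_q` exist and are stable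
equilibria in the interior. -/
theorem minimisers_of_not_irregular {Ω : Type*} {n : ℕ} (hn : 0 < n) {X : Fin n → Ω → Circle}
    {ε : ℝ} (hε : 0 < ε) (hε1 : ε ≤ 1) (q : ℤ) (hq : |(q : ℝ)| * ε < Real.pi)
    (hsmall : 336 * (q : ℝ) ^ 2 * (n * ε ^ 2) < 1) {ω : Ω} (hω : ω ∉ irregular X ε) :
    (∃ z ∈ closure (K n q),
      IsMinOn (energy (rgg (fun i => X i ω) ε) ε) (closure (K n q)) z) ∧
    ∀ z ∈ closure (K n q),
      IsMinOn (energy (rgg (fun i => X i ω) ε) ε) (closure (K n q)) z →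
      z ∈ K n q ∧ ∀ u : Fin n → ℝ, toTorus u = z →
        IsAsymptoticallyStableEquilibrium (field (rgg (fun i => X i ω) ε) ε) u := by
  have hn0 : (0 : ℝ) < n := by exact_mod_cast hn
  have hN0 : (0 : ℝ) < numCells ε := by exact_mod_cast numCells_pos ε
  simp only [irregular, Set.mem_iUnion, Set.mem_union, Set.mem_ofPred_eq, not_exists, not_or,
    not_le, Finset.mem_range] at hω
  obtain ⟨hcyc, hcommon, hK, hS⟩ := rgg_properties hn (fun i => X i ω) (numCells_pos ε)
    (cellWidth_pos ε) (numCells_mul_cellWidth ε) (two_mul_cellWidth_lt hε)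
    (by linarith [two_mul_cellWidth_lt hε, cellWidth_pos ε, Real.pi_gt_three])
    (m := n / (4 * numCells ε)) (by positivity) q hq
    (fun l hl => (hω l hl).1.le) (fun l hl => (hω l hl).2.le)
  refine ⟨exists_isMinOn_closure_K _ ε ⟨_, hK⟩, fun z hz hmin =>
    stable_of_isMinOn hn hε hcyc hcommon hK (hS.trans_lt ?_) hz hmin⟩
  rw [lt_div_iff₀ (by positivity)]
  have h1 := numCells_mul_le hε hε1
  -- The requirement is that the energy of the twisted state stay below `n / (4N)`; the constant is
  -- `336 = 6 · 4 · 14`.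
  calc n * (6 * n * ε) * ((q : ℝ) ^ 2 * ε ^ 2) * (4 * numCells ε)
      = n * (24 * (q : ℝ) ^ 2 * (n * ε ^ 2)) * (numCells ε * ε) := by ring
    _ ≤ n * (24 * (q : ℝ) ^ 2 * (n * ε ^ 2)) * 14 := by gcongr
    _ = n * (336 * (q : ℝ) ^ 2 * (n * ε ^ 2)) := by ring
    _ < n * 1 := by gcongr
    _ = n := mul_one _

theorem eventually_scale {ε : ℕ → ℝ}
    (hε₁ : Tendsto (fun n : ℕ => (n : ℝ) * ε n ^ 2) atTop (𝓝 0))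
    (hε₂ : Tendsto (fun n : ℕ => (n : ℝ) * ε n / Real.log n) atTop atTop) (q : ℤ) :
    ∀ᶠ n : ℕ in atTop, 3 ≤ n ∧ 0 < ε n ∧ ε n ≤ 1 ∧ |(q : ℝ)| * ε n < Real.pi ∧
      336 * (q : ℝ) ^ 2 * (n * ε n ^ 2) < 1 ∧ 112 * Real.log n ≤ n * ε n := by
  have h1 : ∀ᶠ n : ℕ in atTop, 336 * (q : ℝ) ^ 2 * (n * ε n ^ 2) < 1 := by
    have := hε₁.const_mul (336 * (q : ℝ) ^ 2)
    rw [mul_zero] at this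
    exact this.eventually (gt_mem_nhds one_pos)
  filter_upwards [eventually_ge_atTop 3, h1, hε₁.eventually (gt_mem_nhds one_pos),
    hε₂.eventually_ge_atTop 112] with n hn h1 h2 h3
  have hn3 : (3 : ℝ) ≤ n := by exact_mod_cast hn
  have hlog : 0 < Real.log n := Real.log_pos (by linarith)
  rw [le_div_iff₀ hlog] at h3
  -- Positivity of `ε n` comes from `nε ≥ 112 log n > 0`.
  have hpos : 0 < ε n := by
    by_contra! hc
    nlinarith
  refine ⟨hn, hpos, ?_, ?_, h1, h3⟩
  · by_contra! hc
    nlinarith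
  · refine lt_of_pow_lt_pow_left₀ 2 Real.pi_pos.le ?_
    rw [mul_pow, sq_abs]
    have : 0 ≤ (q : ℝ) ^ 2 * ε n ^ 2 := by positivity
    nlinarith [Real.pi_gt_three]

end Kuramoto

theorem theorem1
    (ε : ℕ → ℝ)
    (hε₁ : Tendsto (fun n : ℕ => (n : ℝ) * ε n ^ 2) atTop (𝓝 0))
    (hε₂ : Tendsto (fun n : ℕ => (n : ℝ) * ε n / Real.log n) atTop atTop)
    {Ω : ℕ → Type*} [∀ n, MeasurableSpace (Ω n)]
    (P : ∀ n, Measure (Ω n)) [∀ n, IsProbabilityMeasure (P n)]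
    (X : ∀ n, Fin n → Ω n → Circle)
    (hX_law : ∀ n i, HasLaw (X n i) Kuramoto.uniformCircle (P n))
    (hX_indep : ∀ n, iIndepFun (X n) (P n))
    (q : ℤ) :
    Kuramoto.WithHighProbability P (fun n => {ω |
      ∃ u : Fin n → ℝ, ∑ i, u i = 0 ∧
        Kuramoto.IsAsymptoticallyStableEquilibrium
          (Kuramoto.field (Kuramoto.rgg (fun i => X n i ω) (ε n)) (ε n)) u ∧
        Kuramoto.toTorus u ∈ Kuramoto.K n q}) ∧
    Kuramoto.WithHighProbability P (fun n => {ω |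
      (∃ z ∈ closure (Kuramoto.K n q),
        IsMinOn (Kuramoto.energy (Kuramoto.rgg (fun i => X n i ω) (ε n)) (ε n))
          (closure (Kuramoto.K n q)) z) ∧
      ∀ z ∈ closure (Kuramoto.K n q),
        IsMinOn (Kuramoto.energy (Kuramoto.rgg (fun i => X n i ω) (ε n)) (ε n))
          (closure (Kuramoto.K n q)) z →
        z ∈ interior (Kuramoto.K n q) ∧
        ∀ u : Fin n → ℝ, Kuramoto.toTorus u = z →
          Kuramoto.IsAsymptoticallyStableEquilibrium
            (Kuramoto.field (Kuramoto.rgg (fun i => X n i ω) (ε n)) (ε n)) u}) := by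
  have hscale := Kuramoto.eventually_scale hε₁ hε₂ q
  have hB : ∀ᶠ n in atTop, (P n).real (Kuramoto.irregular (X n) (ε n)) ≤ 28 / (n : ℝ) := by
    filter_upwards [hscale] with n ⟨hn, hpos, h1, _, _, hlog⟩
    exact Kuramoto.measure_irregular_le_div (hX_law n) (hX_indep n) hpos h1 hn hlog
  have hb : Tendsto (fun n : ℕ => 28 / (n : ℝ)) atTop (𝓝 0) :=
    tendsto_const_div_atTop_nhds_zero_nat 28
  refine ⟨Kuramoto.withHighProbability_of_compl_subset ?_ hB hb,
    Kuramoto.withHighProbability_of_compl_subset ?_ hB hb⟩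
  · filter_upwards [hscale] with n ⟨hn, hpos, h1, hq, hsmall, _⟩
    refine Set.compl_subset_comm.1 fun ω hω => ?_
    obtain ⟨⟨z, hz, hmin⟩, hall⟩ :=
      Kuramoto.minimisers_of_not_irregular (by omega) hpos h1 q hq hsmall hω
    obtain ⟨hK, hst⟩ := hall z hz hmin
    -- Any lift of the minimiser is shifted to zero sum; the shift rotates the torus point, which
    -- preserves the index and stability.
    obtain ⟨u, c, hu, hsum⟩ := Kuramoto.exists_sum_eq_zero_toTorus (by omega : 0 < n) z
    refine ⟨fun i => u i + c, hsum,
      Kuramoto.isAsymptoticallyStableEquilibrium_add_const (hst u hu) c, ?_⟩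
    have h2 := Kuramoto.const_mul_mem_K hK (Circle.exp c)
    rw [← hu] at h2
    convert h2 using 1
    funext i
    simp only [Kuramoto.toTorus]
    rw [Circle.exp_add, mul_comm]
  · filter_upwards [hscale] with n ⟨hn, hpos, h1, hq, hsmall, _⟩
    refine Set.compl_subset_comm.1 fun ω hω => ?_
    obtain ⟨hex, hall⟩ :=
      Kuramoto.minimisers_of_not_irregular (by omega) hpos h1 q hq hsmall hω
    refine ⟨hex, fun z hz hmin => ?_⟩
    rw [(Kuramoto.isOpen_K n q).interior_eq]
    exact hall z hz hmin
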